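/- Consider a finite two-player zero-sum factored observation game $G$: finitely many world states and actions, a bounded number of joint (simultaneous) actions, chance transitions, rewards with $\mathcal R_1=-\mathcal R_2$, private and public observations, and each agent knows its legal actions. An infostate $s_i$ is the action-observation history of agent $i$; a public state $p$ is the sequence of public observations; $S_i(p)$ is the set of infostates of agent $i$ possible at $p$. A public belief state (PBS) $\beta=(\beta_1,\beta_2)$ at $p$ consists of a distribution $\beta_i$ over $S_i(p)$ for each agent and stands for the distribution over histories $h$ with public state $p$ that is proportional to $\mathrm{chance}(h)\,\beta_1(s_1(h))\,\beta_2(s_2(h))$. A value network $\hat v$ assigns to each PBS $\beta$ and each infostate $s_i$ in it a real number $\hat v(s_i|\beta)$. *Search.* At a root PBS $\beta$ the algorithm builds the subgame of predetermined depth $\ge 1$ and runs CFR-D (simultaneous regret matching on counterfactual regrets, starting from the uniform profile $\pi^0$) for $T\ge 1$ iterations, which gives profiles $\pi^0,\dots,\pi^T$. On iteration $t$ every non-terminal leaf history $z$ has value $\hat v(s_i(z)|\beta_z^{\pi^t})$ for agent $i$, where $\beta^{\pi^t}_z$ is the PBS that $\pi^t$ induces at the public state of $z$ by Bayes' rule (the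 belief about an agent whose policy gives that public state probability zero is an arbitrary fixed distribution over its infostates there). The search outputs, for every root infostate $s_i$, the average over $t=0,\dots,T$ of its value under $\pi^t$, the expectation being over $p(h|s_i,\beta_{-i})$; this is the value on which $\hat v$ is trained at $\beta$. *Training error.* Call $\beta'$ a leaf PBS of the run if it is obtained from the initial PBS by one or more steps, each going from a PBS $\beta$ to the PBS $\beta^{\pi^t}_z$ at a non-terminal leaf $z$ of the subgame rooted at $\beta$, for some $t\in\{0,\dots,T\}$ with $z$ reachable when at least one of the agents follows $\pi^t$. The network $\hat v$ is trained with error at most $\delta\ge 0$ if, at every leaf PBS $\beta'$ of the run, for each agent $i$ and each non-terminal infostate $s_i$ that is possible given $\beta'_{-i}$, $\hat v(s_i|\beta')$ differs by at most $\delta$ from the value that the search at $\beta'$, using the same $\hat v$ and the same $T$, outputs for $s_i$. (At convergence, the idealized approximator that returns the most recent sampled value has $\delta=0$.) *Test-time play.* Starting at the initial PBS, an agent solves the subgame at its current PBS $\beta$, draws $t$ uniformly from $\{0,\dots,T-1\}$, plays its part of $\pi^t$ in this subgame without exploration, and, when a leaf public state is observed, continues in the same way from the PBS that $\pi^t$ induces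 there, whatever the opponent actually did. There are no further safe-search constraints. The two agents' draws are independent. **Theorem.** There are constants $C_1,C_2\ge 0$ depending only on $G$ such that, for all subgame depths, all $T\ge1$, all $\delta\ge0$ and every value network trained with error at most $\delta$, the two agents' random policies form a $\bigl(\delta C_1+\frac{C_2}{\sqrt T}\bigr)$-Nash equilibrium in expectation: no agent can raise its expected value, taken over the draws as well, by more than $\delta C_1+\frac{C_2}{\sqrt T}$ by switching to any other policy. -/

import Mathlib

noncomputable section

/-- Raw data of a finite two-player zero-sum factored observation game: `legal i w` are the legal
actions of agent `i` at `w`, `trans w a w'` is the probability of moving from `w` to `w'` under the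
joint action `a`, `reward i w a` is agent `i`'s reward, `privObs` / `pubObs` are the private and
public observations, and `horizon` bounds the length of the game. -/
structure FOG (W : Type*) (A : Fin 2 → Type*) (Opriv : Fin 2 → Type*) (Opub : Type*)
    [Fintype W] where
  init : W
  horizon : ℕ
  legal : (i : Fin 2) → W → Finset (A i)
  trans : W → (∀ i, A i) → W → ℝ
  reward : Fin 2 → W → (∀ i, A i) → ℝ
  privObs : (i : Fin 2) → W → (∀ i, A i) → W → Opriv i
  pubObs : W → (∀ i, A i) → W → Opub
  trans_nonneg : ∀ w a w', 0 ≤ trans w a w'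
  trans_sum : ∀ w a, ∑ w', trans w a w' = 1
  zero_sum : ∀ w a, reward 0 w a = - reward 1 w a

namespace FOG

open Classical in
section

variable {W : Type*} {A : Fin 2 → Type*} {Opriv : Fin 2 → Type*} {Opub : Type*}
variable [Fintype W] [∀ i, Fintype (A i)]

/-! ### Histories, infostates, public states (all sequences are stored most recent entry first) -/

/-- The last world state of a history; a history is the list of pairs (joint action, next state). -/
def world (G : FOG W A Opriv Opub) : List ((∀ i, A i) × W) → W
  | [] => G.init
  | x :: _ => x.2

/-- The infostate (action-observation history) of agent `i` at a history. -/
def info (G : FOG W A Opriv Opub) (i : Fin 2) :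
    List ((∀ i, A i) × W) → List (A i × Opriv i × Opub)
  | [] => []
  | x :: h => (x.1 i, G.privObs i (G.world h) x.1 x.2, G.pubObs (G.world h) x.1 x.2) :: G.info i h

/-- The public state of a history. -/
def pub (G : FOG W A Opriv Opub) : List ((∀ i, A i) × W) → List Opub
  | [] => []
  | x :: h => G.pubObs (G.world h) x.1 x.2 :: G.pub h

/-- The public state of an infostate. -/
def pubOfInfo {i : Fin 2} (s : List (A i × Opriv i × Opub)) : List Opub :=
  s.map fun x => x.2.2

/-- A history is terminal if no action is legal at it. -/
def Terminal (G : FOG W A Opriv Opub) (h : List ((∀ i, A i) × W)) : Prop :=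
  ∀ i, G.legal i (G.world h) = ∅

/-- The histories with `n` joint actions: all actions legal, all transitions possible. -/
def hist (G : FOG W A Opriv Opub) : ℕ → Finset (List ((∀ i, A i) × W))
  | 0 => {[]}
  | n + 1 => (((G.hist n) ×ˢ (Finset.univ : Finset ((∀ i, A i) × W))).filter fun x =>
      (∀ i, x.2.1 i ∈ G.legal i (G.world x.1)) ∧ 0 < G.trans (G.world x.1) x.2.1 x.2.2).image
        fun x => x.2 :: x.1

/-- `𝓗(s)`: the histories that correspond to the infostate `s` of agent `i`. -/
def histOf (G : FOG W A Opriv Opub) (i : Fin 2) (s : List (A i × Opriv i × Opub)) :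
    Finset (List ((∀ i, A i) × W)) :=
  (G.hist s.length).filter fun h => G.info i h = s

/-- `S_i(p)`: the infostates that agent `i` may be in given the public state `p`. -/
def infostates (G : FOG W A Opriv Opub) (i : Fin 2) (p : List Opub) :
    Finset (List (A i × Opriv i × Opub)) :=
  ((G.hist p.length).filter fun h => G.pub h = p).image (G.info i)

/-- The actions of agent `i` that are legal at the infostate `s`. -/
def legalAt (G : FOG W A Opriv Opub) (i : Fin 2) (s : List (A i × Opriv i × Opub)) :
    Finset (A i) :=
  Finset.univ.filter fun a => ∃ h ∈ G.histOf i s, a ∈ G.legal i (G.world h)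

/-- The rules make sense: the game ends for both agents at once, an agent knows its legal actions,
and the game is over after at most `horizon` joint actions. -/
structure WellFormed (G : FOG W A Opriv Opub) : Prop where
  ends_together : ∀ w, G.legal 0 w = ∅ ↔ G.legal 1 w = ∅
  legal_known : ∀ i n, ∀ h ∈ G.hist n, ∀ h' ∈ G.hist n, G.info i h = G.info i h' →
    G.legal i (G.world h) = G.legal i (G.world h')
  ends : ∀ h ∈ G.hist G.horizon, G.Terminal h

/-! ### Policies and expected values -/

/-- A policy of agent `i`: a distribution over legal actions for every infostate (there is no
normalization at infostates without legal actions). -/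
structure Policy (G : FOG W A Opriv Opub) (i : Fin 2) where
  prob : List (A i × Opriv i × Opub) → A i → ℝ
  nonneg : ∀ s a, 0 ≤ prob s a
  supp : ∀ s a, a ∉ G.legalAt i s → prob s a = 0
  sum_eq_one : ∀ s, (G.legalAt i s).Nonempty → ∑ a, prob s a = 1

/-- Expected sum of agent `i`'s rewards from history `h` on under the profile `σ`, when play is cut
off after `n` further joint actions and a non-terminal history reached then is worth `leaf`. -/
def value (G : FOG W A Opriv Opub) (σ : ∀ i, G.Policy i) (leaf : List ((∀ i, A i) × W) → ℝ)
    (i : Fin 2) : ℕ → List ((∀ i, A i) × W) → ℝ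
  | 0, h => if G.Terminal h then 0 else leaf h
  | n + 1, h => if G.Terminal h then 0 else
      ∑ a : (∀ i, A i), (∏ j, (σ j).prob (G.info j h) (a j)) *
        (G.reward i (G.world h) a + ∑ w, G.trans (G.world h) a w * G.value σ leaf i n ((a, w) :: h))

/-- The same when agent `i` first plays `b` at `h`; `n` joint actions follow that one. -/
def actionValue (G : FOG W A Opriv Opub) (σ : ∀ i, G.Policy i)
    (leaf : List ((∀ i, A i) × W) → ℝ) (i : Fin 2) (n : ℕ) (h : List ((∀ i, A i) × W))
    (b : A i) : ℝ :=
  ∑ a ∈ (Finset.univ : Finset (∀ i, A i)).filter (fun a => a i = b),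
    (∏ j ∈ Finset.univ.erase i, (σ j).prob (G.info j h) (a j)) *
      (G.reward i (G.world h) a + ∑ w, G.trans (G.world h) a w * G.value σ leaf i n ((a, w) :: h))

/-- `v_i(π)`: the expected value of the whole game. -/
def gameValue (G : FOG W A Opriv Opub) (σ : ∀ i, G.Policy i) (i : Fin 2) : ℝ :=
  G.value σ (fun _ => 0) i G.horizon []

/-- The product of the chance probabilities along a history. -/
def chance (G : FOG W A Opriv Opub) : List ((∀ i, A i) × W) → ℝ
  | [] => 1
  | x :: h => G.chance h * G.trans (G.world h) x.1 x.2

/-! ### Public belief states -/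

/-- A public belief state: a public state and, for each agent, a distribution over its infostates.
It stands for the distribution over histories
`p(h | β) ∝ chance h * range 0 (s_0(h)) * range 1 (s_1(h))`. -/
structure PBS (A : Fin 2 → Type*) (Opriv : Fin 2 → Type*) (Opub : Type*) where
  pub : List Opub
  range : (i : Fin 2) → List (A i × Opriv i × Opub) → ℝ

/-- The PBS at the start of the game. -/
def initialPBS : PBS A Opriv Opub where
  pub := []
  range := fun _ s => if s = [] then 1 else 0

/-- The probability that agent `i` contributes to reaching the infostate `s` of the subgame rooted
at `β`: the root belief times the probabilities of the agent's own actions in the subgame. -/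
def reach {G : FOG W A Opriv Opub} (β : PBS A Opriv Opub) (σ : ∀ i, G.Policy i) (i : Fin 2) :
    List (A i × Opriv i × Opub) → ℝ
  | [] => β.range i []
  | x :: s => if s.length < β.pub.length then β.range i (x :: s)
      else reach β σ i s * (σ i).prob s x.1

/-- Counterfactual reach for agent `i` of the history `h` of the subgame rooted at `β`:
the contributions of chance and of the other agent. -/
def cfReach (G : FOG W A Opriv Opub) (β : PBS A Opriv Opub) (σ : ∀ i, G.Policy i) (i : Fin 2)
    (h : List ((∀ i, A i) × W)) : ℝ :=
  G.chance h * ∏ j ∈ Finset.univ.erase i, reach β σ j (G.info j h)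

/-- The parameters of the algorithm: the depth of the subgame built at each public state, the number
of CFR iterations per subgame, the value network, and the belief that is used for an agent at a
public state to which the policy of that agent gives probability zero (Bayes' rule is silent
there, so any distribution over the possible infostates is allowed). -/
structure Search (G : FOG W A Opriv Opub) where
  depth : List Opub → ℕ
  depth_pos : ∀ p, 0 < depth p
  T : ℕ
  T_pos : 0 < T
  vhat : PBS A Opriv Opub → (i : Fin 2) → List (A i × Opriv i × Opub) → ℝ
  offBelief : (i : Fin 2) → List Opub → List (A i × Opriv i × Opub) → ℝ
  offBelief_nonneg : ∀ i p s, 0 ≤ offBelief i p s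
  offBelief_supp : ∀ i p s, s ∉ G.infostates i p → offBelief i p s = 0
  offBelief_sum : ∀ i p, (G.infostates i p).Nonempty →
    ∑ s ∈ G.infostates i p, offBelief i p s = 1

/-- The PBS at the public state `p` when `σ` is played from `β` on (Bayes' rule). -/
def leafPBS {G : FOG W A Opriv Opub} (S : G.Search) (β : PBS A Opriv Opub) (σ : ∀ i, G.Policy i)
    (p : List Opub) : PBS A Opriv Opub where
  pub := p
  range := fun i s =>
    if ∑ s' ∈ G.infostates i p, reach β σ i s' = 0 then S.offBelief i p s
    else if s ∈ G.infostates i p then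
      reach β σ i s / ∑ s' ∈ G.infostates i p, reach β σ i s'
    else 0

/-! ### CFR-D in the depth-limited subgame rooted at a PBS -/

/-- The value that the network gives to agent `i` at the leaf history `h` when `σ` is played. -/
def leafValue {G : FOG W A Opriv Opub} (S : G.Search) (β : PBS A Opriv Opub)
    (σ : ∀ i, G.Policy i) (i : Fin 2) (h : List ((∀ i, A i) × W)) : ℝ :=
  S.vhat (leafPBS S β σ (G.pub h)) i (G.info i h)

/-- Number of joint actions left in the subgame rooted at `β` after `m` joint actions of the
whole game. -/
def stepsLeft {G : FOG W A Opriv Opub} (S : G.Search) (β : PBS A Opriv Opub) (m : ℕ) : ℕ :=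
  β.pub.length + S.depth β.pub - m

/-- Instantaneous counterfactual regret of agent `i` at `s` for not playing `b`. -/
def instRegret {G : FOG W A Opriv Opub} (S : G.Search) (β : PBS A Opriv Opub)
    (σ : ∀ i, G.Policy i) (i : Fin 2) (s : List (A i × Opriv i × Opub)) (b : A i) : ℝ :=
  ∑ h ∈ G.histOf i s, G.cfReach β σ i h *
    (G.actionValue σ (leafValue S β σ i) i (stepsLeft S β s.length - 1) h b -
      G.value σ (leafValue S β σ i) i (stepsLeft S β s.length) h)

/-- Regret matching: probabilities proportional to the positive parts of the cumulative regrets of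
the legal actions, uniform if none is positive. -/
def regretMatching (G : FOG W A Opriv Opub) (i : Fin 2)
    (R : List (A i × Opriv i × Opub) → A i → ℝ) : G.Policy i where
  prob := fun s a =>
    if a ∈ G.legalAt i s then
      if 0 < ∑ b ∈ G.legalAt i s, max (R s b) 0 then
        max (R s a) 0 / ∑ b ∈ G.legalAt i s, max (R s b) 0
      else 1 / ((G.legalAt i s).card : ℝ)
    else 0
  nonneg := by
    intro s a
    split_ifs <;> positivity
  supp := by
    intro s a h
    simp [h]
  sum_eq_one := by
    intro s hs
    rw [Finset.sum_ite_mem, Finset.univ_inter]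
    split_ifs with h
    · rw [← Finset.sum_div, div_self h.ne']
    · have : ((G.legalAt i s).card : ℝ) ≠ 0 := by
        exact_mod_cast hs.card_pos.ne'
      rw [Finset.sum_const, nsmul_eq_mul, mul_one_div, div_self this]

/-- Cumulative counterfactual regrets before iteration `t` is played. -/
def cumRegret {G : FOG W A Opriv Opub} (S : G.Search) (β : PBS A Opriv Opub) :
    ℕ → (i : Fin 2) → List (A i × Opriv i × Opub) → A i → ℝ
  | 0 => fun _ _ _ => 0
  | t + 1 => fun i s b => cumRegret S β t i s b +
      instRegret S β (fun j => G.regretMatching j (cumRegret S β t j)) i s b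

/-- `π^t`, the policy profile of iteration `t`; `π^0` is uniform. -/
def iterate {G : FOG W A Opriv Opub} (S : G.Search) (β : PBS A Opriv Opub) (t : ℕ) :
    ∀ i, G.Policy i :=
  fun i => G.regretMatching i (cumRegret S β t i)

/-- `∑_{h ∈ 𝓗(s)}` of the chance probability times the belief of the other agent: the weight of the
root infostate `s` of `β`, positive iff `s` is possible given `β_{-i}`. -/
def rootWeight (G : FOG W A Opriv Opub) (β : PBS A Opriv Opub) (i : Fin 2)
    (s : List (A i × Opriv i × Opub)) : ℝ :=
  ∑ h ∈ G.histOf i s, G.chance h * ∏ j ∈ Finset.univ.erase i, β.range j (G.info j h)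

/-- `v^σ(s | β)`: the value of the root infostate `s` of the depth-limited subgame at `β` under `σ`
and the network's leaf values, the expectation over `p(h | s, β_{-i})` of the value of `h`. -/
def rootValue {G : FOG W A Opriv Opub} (S : G.Search) (β : PBS A Opriv Opub)
    (σ : ∀ i, G.Policy i) (i : Fin 2) (s : List (A i × Opriv i × Opub)) : ℝ :=
  (∑ h ∈ G.histOf i s, (G.chance h * ∏ j ∈ Finset.univ.erase i, β.range j (G.info j h)) *
    G.value σ (leafValue S β σ i) i (S.depth β.pub) h) / G.rootWeight β i s

/-- The value that the search at `β` outputs for `s` and on which the network is trained: start with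
the value under `π^0`, and for `t = 1, …, T` average in the value under `π^t` with
weight `1 / (t + 1)`. -/
def trainingValue {G : FOG W A Opriv Opub} (S : G.Search) (β : PBS A Opriv Opub)
    (i : Fin 2) (s : List (A i × Opriv i × Opub)) : ℕ → ℝ
  | 0 => rootValue S β (iterate S β 0) i s
  | t + 1 => ((t + 1 : ℝ) / (t + 2)) * trainingValue S β i s t +
      (1 / (t + 2 : ℝ)) * rootValue S β (iterate S β (t + 1)) i s

/-! ### Leaf PBSs and the error of the value network -/

/-- `β'` is the PBS at a leaf of the depth-limited subgame rooted at `β` on some CFR iteration, the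
leaf not requiring both agents to leave the policy of that iteration. -/
def IsLeafPBS {G : FOG W A Opriv Opub} (S : G.Search) (β β' : PBS A Opriv Opub) : Prop :=
  ∃ t ≤ S.T, ∃ h ∈ G.hist (β.pub.length + S.depth β.pub), β.pub <:+ G.pub h ∧ ¬ G.Terminal h ∧
    (∃ i, 0 < G.cfReach β (iterate S β t) i h) ∧ β' = leafPBS S β (iterate S β t) (G.pub h)

/-- The network has been trained with error at most `δ`: at every leaf PBS that the algorithm can
encounter, and every (possible, non-terminal) infostate in it, the network is within `δ` of the
value that the algorithm, with this network at its own leaves, computes there. -/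
def TrainedWithError {G : FOG W A Opriv Opub} (S : G.Search) (δ : ℝ) : Prop :=
  ∀ β : PBS A Opriv Opub, Relation.TransGen (IsLeafPBS S) initialPBS β →
    ∀ i, ∀ s ∈ G.infostates i β.pub, (G.legalAt i s).Nonempty → 0 < G.rootWeight β i s →
      |S.vhat β i s - trainingValue S β i s S.T| ≤ δ

/-! ### Play at test time -/

/-- Random seeds of one agent: entry `k` is the iteration in `{0, …, T - 1}` that the agent draws
for a subgame rooted after `k` joint actions. -/
abbrev Seed {G : FOG W A Opriv Opub} (S : G.Search) : Type := Fin G.horizon → Fin S.T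

/-- The iteration drawn for a subgame rooted after `k` joint actions. -/
def drawn {G : FOG W A Opriv Opub} (S : G.Search) (ω : Seed S) (k : ℕ) : ℕ :=
  if hk : k < G.horizon then (ω ⟨k, hk⟩ : ℕ) else 0

/-- The root PBS of the subgame that the agent is searching at the public state `p`, and the number
of joint actions left in this subgame. When a leaf is reached, the next subgame is rooted at the
PBS that the policy profile of the drawn iteration induces at the observed public state. -/
def current {G : FOG W A Opriv Opub} (S : G.Search) (ω : Seed S) :
    List Opub → PBS A Opriv Opub × ℕ
  | [] => (initialPBS, S.depth [])
  | o :: p =>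
      if (current S ω p).2 ≤ 1 then
        (leafPBS S (current S ω p).1
          (iterate S (current S ω p).1 (drawn S ω (current S ω p).1.pub.length)) (o :: p),
          S.depth (o :: p))
      else ((current S ω p).1, (current S ω p).2 - 1)

/-- The policy that agent `i` plays with seed `ω`: in every subgame, that of the drawn iteration. -/
def testPolicy {G : FOG W A Opriv Opub} (S : G.Search) (i : Fin 2) (ω : Seed S) : G.Policy i where
  prob := fun s => (iterate S (current S ω (pubOfInfo s)).1
    (drawn S ω (current S ω (pubOfInfo s)).1.pub.length) i).prob s
  nonneg := fun s => (iterate S (current S ω (pubOfInfo s)).1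
    (drawn S ω (current S ω (pubOfInfo s)).1.pub.length) i).nonneg s
  supp := fun s => (iterate S (current S ω (pubOfInfo s)).1
    (drawn S ω (current S ω (pubOfInfo s)).1.pub.length) i).supp s
  sum_eq_one := fun s => (iterate S (current S ω (pubOfInfo s)).1
    (drawn S ω (current S ω (pubOfInfo s)).1.pub.length) i).sum_eq_one s

/-- The random policies that the two agents play, with independent uniform seeds, form an `ε`-Nash
equilibrium in expectation: no agent gains more than `ε` by switching to any other policy. -/
def PlaysNashInExpectation {G : FOG W A Opriv Opub} (S : G.Search) (ε : ℝ) : Prop :=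
  ∀ (i : Fin 2) (π : G.Policy i),
    Finset.expect Finset.univ (fun ω : Fin 2 → Seed S =>
        G.gameValue (Function.update (fun j => testPolicy S j (ω j)) i π) i) ≤
      Finset.expect Finset.univ (fun ω : Fin 2 → Seed S =>
        G.gameValue (fun j => testPolicy S j (ω j)) i) + ε

end

end FOG

end

set_option linter.unusedSectionVars false
noncomputable section

namespace FOG

open Classical Finset

variable {W : Type*} {A : Fin 2 → Type*} {Opriv : Fin 2 → Type*} {Opub : Type*}
variable [Fintype W] [∀ i, Fintype (A i)]

/-! ### Histories, infostates and counting bounds -/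

section Histories

variable {G : FOG W A Opriv Opub}

/-! Everything that counts for agent `i` against a fixed opponent (counterfactual reach, the weights
of root histories) involves only chance and the belief about the other agent. At a leaf public state
the counterfactual reach under `π^t` equals the root weight of the leaf PBS up to one factor common
to the whole public state (`PBS.Valid.cfReach_eq`). So the regret accounting of a subgame continues
into the next subgame, no matter how agent `i` got there; this is why no safe-search constraint is
needed.

Inside one subgame regret matching keeps cumulative regrets of order `√T` (`cumRegret_le`), once
values are known to be bounded wherever the counterfactual reach is positive
(`Reachable.abs_value_le`). The CFR decomposition (`cfGain_succ`, `sum_cfGain_le`) bounds the gain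
of a fixed deviation by these regrets plus the gain at the leaves. A leaf gain splits into three:
the deviator's gain over `playedValue`, the average over the iterates that may be drawn in the next
subgame, small by induction; the gap between that average and the search output, of order `1/T`
because the search averages one more iterate; and the gap of at most `δ` between search output and
network. Induction on the remaining length of the game gives `exists_deviationValue_le`: against the
opponent's random play no policy earns more than `playedValue` plus `O(δ + 1/√T)`. Fresh draws in
each subgame turn expected test-time play into the recursion `deviationValue`
(`expect_seededValue`).

A second induction (`exists_totalValue_le`) shows that the two agents' played values at the start of
the game sum to `O(δ)`. An agent's own test policy is itself a deviation, so the other agent earns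
at most its played value plus the error; by the zero-sum property this bounds agent `i`'s expected
value from below, and the bounds combine in `exists_playsNashInExpectation`. -/

theorem cons_mem_hist {n : ℕ} {a : ∀ i, A i} {w : W} {h : List ((∀ i, A i) × W)} :
    (a, w) :: h ∈ G.hist (n + 1) ↔
      h ∈ G.hist n ∧ (∀ i, a i ∈ G.legal i (G.world h)) ∧ 0 < G.trans (G.world h) a w := by
  simp only [hist, mem_image, mem_filter, mem_product, mem_univ, and_true, Prod.exists,
    List.cons.injEq, Prod.mk.injEq]
  constructor
  · rintro ⟨h', a', w', ⟨h1, h2, h3⟩, ⟨rfl, rfl⟩, rfl⟩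
    exact ⟨h1, h2, h3⟩
  · rintro ⟨h1, h2, h3⟩
    exact ⟨h, a, w, ⟨h1, h2, h3⟩, ⟨rfl, rfl⟩, rfl⟩

theorem exists_of_mem_hist_succ {n : ℕ} {h : List ((∀ i, A i) × W)} (hh : h ∈ G.hist (n + 1)) :
    ∃ a w h', h = (a, w) :: h' := by
  simp only [hist, mem_image, Prod.exists] at hh
  obtain ⟨h', a, w, -, rfl⟩ := hh
  exact ⟨a, w, h', rfl⟩

theorem length_of_mem_hist {n : ℕ} {h : List ((∀ i, A i) × W)} (hh : h ∈ G.hist n) :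
    h.length = n := by
  induction n generalizing h with
  | zero => simp only [hist, mem_singleton] at hh; simp [hh]
  | succ n ih =>
    obtain ⟨a, w, h', rfl⟩ := exists_of_mem_hist_succ hh
    simp [ih (cons_mem_hist.1 hh).1]

@[simp] theorem info_length (i : Fin 2) (h : List ((∀ i, A i) × W)) :
    (G.info i h).length = h.length := by
  induction h with
  | nil => rfl
  | cons x h ih => simp [info, ih]

@[simp] theorem pub_length (h : List ((∀ i, A i) × W)) : (G.pub h).length = h.length := by
  induction h with
  | nil => rfl
  | cons x h ih => simp [pub, ih]

@[simp] theorem pubOfInfo_info (i : Fin 2) (h : List ((∀ i, A i) × W)) :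
    pubOfInfo (G.info i h) = G.pub h := by
  induction h with
  | nil => rfl
  | cons x h ih => simpa [info, pub, pubOfInfo] using ih

theorem mem_histOf {i : Fin 2} {s : List (A i × Opriv i × Opub)} {h : List ((∀ i, A i) × W)} :
    h ∈ G.histOf i s ↔ h ∈ G.hist s.length ∧ G.info i h = s := by
  simp [histOf]

theorem mem_histOf_info {i : Fin 2} {n : ℕ} {h : List ((∀ i, A i) × W)} (hh : h ∈ G.hist n) :
    h ∈ G.histOf i (G.info i h) := by
  rw [mem_histOf, info_length, length_of_mem_hist hh]
  exact ⟨hh, rfl⟩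

theorem mem_infostates {i : Fin 2} {p : List Opub} {s : List (A i × Opriv i × Opub)} :
    s ∈ G.infostates i p ↔ ∃ h ∈ G.hist p.length, G.pub h = p ∧ G.info i h = s := by
  simp [infostates, and_assoc]

theorem info_mem_infostates {n : ℕ} {h : List ((∀ i, A i) × W)} (hh : h ∈ G.hist n) (i : Fin 2) :
    G.info i h ∈ G.infostates i (G.pub h) := by
  rw [mem_infostates, pub_length, length_of_mem_hist hh]
  exact ⟨h, hh, rfl, rfl⟩

theorem length_of_mem_infostates {i : Fin 2} {p : List Opub} {s : List (A i × Opriv i × Opub)}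
    (hs : s ∈ G.infostates i p) : s.length = p.length := by
  obtain ⟨h, hh, rfl, rfl⟩ := mem_infostates.1 hs
  simp

theorem pubOfInfo_of_mem_infostates {i : Fin 2} {p : List Opub} {s : List (A i × Opriv i × Opub)}
    (hs : s ∈ G.infostates i p) : pubOfInfo s = p := by
  obtain ⟨h, hh, rfl, rfl⟩ := mem_infostates.1 hs
  simp

theorem pub_of_mem_histOf {i : Fin 2} {s : List (A i × Opriv i × Opub)}
    {h : List ((∀ i, A i) × W)} (hh : h ∈ G.histOf i s) : G.pub h = pubOfInfo s := by
  rw [← (mem_histOf.1 hh).2, pubOfInfo_info]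

theorem WellFormed.legalAt_info (hG : G.WellFormed) {n : ℕ} {h : List ((∀ i, A i) × W)}
    (hh : h ∈ G.hist n) (i : Fin 2) : G.legalAt i (G.info i h) = G.legal i (G.world h) := by
  ext a
  simp only [legalAt, mem_filter, mem_univ, true_and]
  constructor
  · rintro ⟨h', hh', ha⟩
    rw [mem_histOf, info_length, length_of_mem_hist hh] at hh'
    rwa [← hG.legal_known i n h' hh'.1 h hh hh'.2]
  · exact fun ha => ⟨h, mem_histOf_info hh, ha⟩

theorem WellFormed.terminal_iff (hG : G.WellFormed) (h : List ((∀ i, A i) × W)) (i : Fin 2) :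
    G.Terminal h ↔ G.legal i (G.world h) = ∅ := by
  refine ⟨fun hT => hT i, fun hi j => ?_⟩
  have key := hG.ends_together (G.world h)
  fin_cases i <;> fin_cases j <;> simp_all

theorem WellFormed.terminal_iff_legalAt (hG : G.WellFormed) {n : ℕ} {h : List ((∀ i, A i) × W)}
    (hh : h ∈ G.hist n) (i : Fin 2) : G.Terminal h ↔ G.legalAt i (G.info i h) = ∅ := by
  rw [hG.terminal_iff h i, hG.legalAt_info hh]

theorem WellFormed.terminal_congr (hG : G.WellFormed) {i : Fin 2}
    {s : List (A i × Opriv i × Opub)} {h h' : List ((∀ i, A i) × W)} (hh : h ∈ G.histOf i s)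
    (hh' : h' ∈ G.histOf i s) (hT : G.Terminal h) : G.Terminal h' := by
  rw [mem_histOf] at hh hh'
  rw [hG.terminal_iff_legalAt hh'.1 i, hh'.2, ← hh.2]
  exact (hG.terminal_iff_legalAt hh.1 i).1 hT

theorem WellFormed.hist_eq_empty (hG : G.WellFormed) (n : ℕ) :
    G.hist (G.horizon + 1 + n) = ∅ := by
  induction n with
  | zero =>
    refine eq_empty_of_forall_notMem fun h hh => ?_
    obtain ⟨a, w, h', rfl⟩ := exists_of_mem_hist_succ hh
    obtain ⟨h1, h2, -⟩ := cons_mem_hist.1 hh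
    simpa [hG.ends h' h1 0] using h2 0
  | succ n ih =>
    refine eq_empty_of_forall_notMem fun h hh => ?_
    obtain ⟨a, w, h', rfl⟩ := exists_of_mem_hist_succ hh
    simpa [ih] using (cons_mem_hist.1 hh).1

theorem WellFormed.le_horizon (hG : G.WellFormed) {n : ℕ} {h : List ((∀ i, A i) × W)}
    (hh : h ∈ G.hist n) : n ≤ G.horizon := by
  by_contra! hn
  obtain ⟨k, rfl⟩ := Nat.exists_eq_add_of_lt hn
  rw [show G.horizon + k + 1 = G.horizon + 1 + k by ring, hG.hist_eq_empty] at hh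
  simp at hh

theorem WellFormed.lt_horizon (hG : G.WellFormed) {n : ℕ} {h : List ((∀ i, A i) × W)}
    (hh : h ∈ G.hist n) (hT : ¬ G.Terminal h) : n < G.horizon := by
  refine lt_of_le_of_ne (hG.le_horizon hh) ?_
  rintro rfl
  exact hT (hG.ends h hh)

theorem trans_le_one (w : W) (a : ∀ i, A i) (w' : W) : G.trans w a w' ≤ 1 := by
  rw [← G.trans_sum w a]
  exact single_le_sum (fun x _ => G.trans_nonneg w a x) (mem_univ w')

theorem chance_nonneg (h : List ((∀ i, A i) × W)) : 0 ≤ G.chance h := by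
  induction h with
  | nil => simp [chance]
  | cons x h ih => exact mul_nonneg ih (G.trans_nonneg _ _ _)

theorem chance_le_one (h : List ((∀ i, A i) × W)) : G.chance h ≤ 1 := by
  induction h with
  | nil => simp [chance]
  | cons x h ih => exact mul_le_one₀ ih (G.trans_nonneg _ _ _) (trans_le_one _ _ _)

variable (G) in
/-- The number of histories. -/
def numHist : ℝ := ∑ n ∈ range (G.horizon + 1), ((G.hist n).card : ℝ)

theorem WellFormed.card_hist_le (hG : G.WellFormed) (n : ℕ) :
    ((G.hist n).card : ℝ) ≤ G.numHist := by
  by_cases hn : n ≤ G.horizon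
  · exact single_le_sum (f := fun n => ((G.hist n).card : ℝ)) (fun _ _ => by positivity)
      (mem_range.2 (by omega))
  · have : G.hist n = ∅ := eq_empty_of_forall_notMem fun h hh => hn (hG.le_horizon hh)
    rw [this]
    simp only [card_empty, Nat.cast_zero]
    exact sum_nonneg fun _ _ => by positivity

theorem WellFormed.one_le_numHist (hG : G.WellFormed) : 1 ≤ G.numHist := by
  simpa [hist] using hG.card_hist_le 0

theorem WellFormed.card_histOf_le (hG : G.WellFormed) (i : Fin 2)
    (s : List (A i × Opriv i × Opub)) : ((G.histOf i s).card : ℝ) ≤ G.numHist :=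
  (Nat.cast_le.2 (card_filter_le _ _)).trans (hG.card_hist_le _)

theorem WellFormed.card_infostates_le (hG : G.WellFormed) (i : Fin 2) (p : List Opub) :
    ((G.infostates i p).card : ℝ) ≤ G.numHist :=
  (Nat.cast_le.2 (card_image_le.trans (card_filter_le _ _))).trans (hG.card_hist_le _)

variable (G) in
/-- The infostates of agent `i` that may follow `s` when the agent plays `b`. -/
def children (i : Fin 2) (s : List (A i × Opriv i × Opub)) (b : A i) :
    Finset (List (A i × Opriv i × Opub)) :=
  ((G.hist (s.length + 1)).image (G.info i)).filter fun s' => ∃ o, s' = (b, o) :: s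

theorem WellFormed.card_children_le (hG : G.WellFormed) (i : Fin 2)
    (s : List (A i × Opriv i × Opub)) (b : A i) : ((G.children i s b).card : ℝ) ≤ G.numHist :=
  (Nat.cast_le.2 ((card_filter_le _ _).trans card_image_le)).trans (hG.card_hist_le _)

/-- Summing over the histories one step after `s` and `b` is summing over the child infostates. -/
theorem sum_children (i : Fin 2) (s : List (A i × Opriv i × Opub)) (b : A i)
    (F : List ((∀ i, A i) × W) → ℝ)
    (hF : ∀ h ∈ G.histOf i s, ∀ a w, a i = b → (a, w) :: h ∉ G.hist (s.length + 1) →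
      F ((a, w) :: h) = 0) :
    ∑ h ∈ G.histOf i s, ∑ a ∈ univ.filter (fun a : ∀ i, A i => a i = b), ∑ w, F ((a, w) :: h) =
      ∑ s' ∈ G.children i s b, ∑ h ∈ G.histOf i s', F h := by
  have e1 : ∑ s' ∈ G.children i s b, ∑ h ∈ G.histOf i s', F h =
      ∑ h ∈ (G.hist (s.length + 1)).filter (fun h => G.info i h ∈ G.children i s b), F h := by
    rw [← sum_fiberwise_of_maps_to (t := G.children i s b) (g := G.info i)
      (fun h hh => (mem_filter.1 hh).2)]
    refine sum_congr rfl fun s' hs' => sum_congr ?_ fun _ _ => rfl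
    ext h
    obtain ⟨o, ho⟩ := (mem_filter.1 hs').2
    have hl : s'.length = s.length + 1 := by simp [ho]
    simp only [mem_histOf, mem_filter, hl]
    constructor
    · rintro ⟨h1, rfl⟩; exact ⟨⟨h1, hs'⟩, rfl⟩
    · rintro ⟨⟨h1, -⟩, h2⟩; exact ⟨h1, h2⟩
  rw [e1]
  simp_rw [← sum_product']
  -- Only triples that extend to a possible history contribute, and on these prepending the last
  -- step is a bijection.
  rw [← sum_filter_of_ne
    (p := fun x : List ((∀ i, A i) × W) × (∀ i, A i) × W => x.2 :: x.1 ∈ G.hist (s.length + 1))]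
  · refine sum_nbij (fun x => x.2 :: x.1) ?_ ?_ ?_ ?_
    · rintro ⟨h, a, w⟩ hx
      simp only [mem_filter, mem_product, mem_univ, and_true, true_and, mem_histOf] at hx
      obtain ⟨⟨⟨-, rfl⟩, rfl⟩, h2⟩ := hx
      exact mem_filter.2 ⟨h2, mem_filter.2 ⟨mem_image_of_mem _ h2, _, rfl⟩⟩
    · rintro ⟨h, a, w⟩ - ⟨h', a', w'⟩ - heq
      simp_all
    · intro h hh
      obtain ⟨h1, h2⟩ := mem_filter.1 hh
      obtain ⟨a, w, h', rfl⟩ := exists_of_mem_hist_succ h1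
      obtain ⟨-, o, ho⟩ := mem_filter.1 h2
      simp only [info, List.cons.injEq, Prod.mk.injEq] at ho
      refine ⟨(h', a, w), ?_, rfl⟩
      simp only [coe_filter, mem_product, mem_univ, and_true, true_and, mem_histOf, mem_filter,
        Set.mem_ofPred_eq]
      exact ⟨⟨⟨(cons_mem_hist.1 h1).1, ho.2⟩, ho.1.1⟩, h1⟩
    · intro x _; rfl
  · rintro ⟨h, a, w⟩ hx hne
    simp only [mem_filter, mem_product, mem_univ, and_true, true_and] at hx
    by_contra hn
    exact hne (hF h hx.1 a w hx.2 hn)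

end Histories

/-! ### Reach probabilities and belief states -/

section Beliefs

variable {G : FOG W A Opriv Opub}

theorem Policy.prob_le_one {i : Fin 2} (σ : G.Policy i) (s : List (A i × Opriv i × Opub))
    (a : A i) : σ.prob s a ≤ 1 := by
  by_cases ha : a ∈ G.legalAt i s
  · rw [← σ.sum_eq_one s ⟨a, ha⟩]
    exact single_le_sum (fun x _ => σ.nonneg s x) (mem_univ a)
  · rw [σ.supp s a ha]
    exact zero_le_one

theorem reach_of_length_le (β : PBS A Opriv Opub) (σ : ∀ i, G.Policy i) (i : Fin 2)
    {s : List (A i × Opriv i × Opub)} (hs : s.length ≤ β.pub.length) :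
    reach β σ i s = β.range i s := by
  cases s with
  | nil => rfl
  | cons x s => exact if_pos (by simpa using hs)

theorem reach_cons (β : PBS A Opriv Opub) (σ : ∀ i, G.Policy i) (i : Fin 2)
    (x : A i × Opriv i × Opub) {s : List (A i × Opriv i × Opub)}
    (hs : β.pub.length ≤ s.length) :
    reach β σ i (x :: s) = reach β σ i s * (σ i).prob s x.1 :=
  if_neg (by omega)

theorem cfReach_of_length_le (β : PBS A Opriv Opub) (σ : ∀ i, G.Policy i) (i : Fin 2)
    {h : List ((∀ i, A i) × W)} (hh : h.length ≤ β.pub.length) :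
    G.cfReach β σ i h = G.chance h * ∏ j ∈ univ.erase i, β.range j (G.info j h) := by
  rw [cfReach]
  congr 1
  exact prod_congr rfl fun j _ => reach_of_length_le β σ j (by simpa using hh)

theorem cfReach_cons (β : PBS A Opriv Opub) (σ : ∀ i, G.Policy i) (i : Fin 2)
    (a : ∀ i, A i) (w : W) {h : List ((∀ i, A i) × W)} (hh : β.pub.length ≤ h.length) :
    G.cfReach β σ i ((a, w) :: h) = G.cfReach β σ i h *
      ((∏ j ∈ univ.erase i, (σ j).prob (G.info j h) (a j)) * G.trans (G.world h) a w) := by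
  have : ∀ j, reach β σ j (G.info j ((a, w) :: h)) =
      reach β σ j (G.info j h) * (σ j).prob (G.info j h) (a j) :=
    fun j => reach_cons β σ j _ (by simpa using hh)
  simp only [cfReach, this, prod_mul_distrib, chance]
  ring

/-- The beliefs are weights in `[0, 1]`. -/
def PBS.Valid (β : PBS A Opriv Opub) : Prop := ∀ i s, 0 ≤ β.range i s ∧ β.range i s ≤ 1

theorem PBS.Valid.reach_mem {β : PBS A Opriv Opub} (hβ : β.Valid) (σ : ∀ i, G.Policy i)
    (i : Fin 2) (s : List (A i × Opriv i × Opub)) : 0 ≤ reach β σ i s ∧ reach β σ i s ≤ 1 := by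
  induction s with
  | nil => exact hβ i []
  | cons x s ih =>
    by_cases hs : s.length < β.pub.length
    · rw [reach_of_length_le β σ i (by simpa using hs)]; exact hβ i _
    · rw [reach_cons β σ i x (by omega)]
      exact ⟨mul_nonneg ih.1 ((σ i).nonneg _ _),
        mul_le_one₀ ih.2 ((σ i).nonneg _ _) ((σ i).prob_le_one _ _)⟩

theorem PBS.Valid.cfReach_nonneg {β : PBS A Opriv Opub} (hβ : β.Valid) (σ : ∀ i, G.Policy i)
    (i : Fin 2) (h : List ((∀ i, A i) × W)) : 0 ≤ G.cfReach β σ i h :=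
  mul_nonneg (chance_nonneg h) (prod_nonneg fun j _ => (hβ.reach_mem σ j _).1)

theorem PBS.Valid.cfReach_le_one {β : PBS A Opriv Opub} (hβ : β.Valid) (σ : ∀ i, G.Policy i)
    (i : Fin 2) (h : List ((∀ i, A i) × W)) : G.cfReach β σ i h ≤ 1 :=
  mul_le_one₀ (chance_le_one h) (prod_nonneg fun j _ => (hβ.reach_mem σ j _).1)
    (prod_le_one (fun j _ => (hβ.reach_mem σ j _).1) fun j _ => (hβ.reach_mem σ j _).2)

/-- The total reach of the infostates of agent `i` at a public state. -/
def pubReach {G : FOG W A Opriv Opub} (β : PBS A Opriv Opub) (σ : ∀ i, G.Policy i) (i : Fin 2)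
    (p : List Opub) : ℝ := ∑ s ∈ G.infostates i p, reach β σ i s

theorem PBS.Valid.pubReach_nonneg {β : PBS A Opriv Opub} (hβ : β.Valid) (σ : ∀ i, G.Policy i)
    (i : Fin 2) (p : List Opub) : 0 ≤ pubReach β σ i p :=
  sum_nonneg fun s _ => (hβ.reach_mem σ i s).1

theorem PBS.Valid.pubReach_le (hG : G.WellFormed) {β : PBS A Opriv Opub} (hβ : β.Valid)
    (σ : ∀ i, G.Policy i) (i : Fin 2) (p : List Opub) : pubReach β σ i p ≤ G.numHist := by
  refine (sum_le_card_nsmul _ _ 1 fun s _ => (hβ.reach_mem σ i s).2).trans ?_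
  simpa using hG.card_infostates_le i p

/-- Bayes' rule in a form without division. If the public reach vanishes, so does every single
reach, and both sides are zero whatever the off-path belief is. -/
theorem PBS.Valid.reach_eq {β : PBS A Opriv Opub} (hβ : β.Valid) (S : G.Search)
    (σ : ∀ i, G.Policy i) (i : Fin 2) {p : List Opub} {s : List (A i × Opriv i × Opub)}
    (hs : s ∈ G.infostates i p) :
    reach β σ i s = pubReach β σ i p * (leafPBS S β σ p).range i s := by
  change _ = _ * (if pubReach β σ i p = 0 then _ else if s ∈ _ then _ / pubReach β σ i p else 0)
  split_ifs with h0
  · rw [h0, zero_mul]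
    exact (sum_eq_zero_iff_of_nonneg fun s _ => (hβ.reach_mem σ i s).1).1 h0 s hs
  · field_simp

theorem PBS.Valid.leafPBS_valid {β : PBS A Opriv Opub} (hβ : β.Valid) (S : G.Search)
    (σ : ∀ i, G.Policy i) (p : List Opub) : (leafPBS S β σ p).Valid := by
  intro i s
  simp only [leafPBS]
  split_ifs with h0 hs
  · refine ⟨S.offBelief_nonneg i p s, ?_⟩
    by_cases hs : s ∈ G.infostates i p
    · rw [← S.offBelief_sum i p ⟨s, hs⟩]
      exact single_le_sum (fun x _ => S.offBelief_nonneg i p x) hs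
    · rw [S.offBelief_supp i p s hs]; exact zero_le_one
  · have hn : ∀ s' ∈ G.infostates i p, 0 ≤ reach β σ i s' := fun s' _ => (hβ.reach_mem σ i s').1
    exact ⟨div_nonneg (hn s hs) (sum_nonneg hn), div_le_one_of_le₀ (single_le_sum hn hs)
      (sum_nonneg hn)⟩
  · simp

/-- The link between consecutive subgames: the factor in front depends on `h` only through its
public state, hence is constant on an infostate of agent `i`, and the rest is the root weight of `h`
in the leaf PBS. -/
theorem PBS.Valid.cfReach_eq {β : PBS A Opriv Opub} (hβ : β.Valid) (S : G.Search)
    (σ : ∀ i, G.Policy i) (i : Fin 2) {n : ℕ} {h : List ((∀ i, A i) × W)} (hh : h ∈ G.hist n) :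
    G.cfReach β σ i h = (∏ j ∈ univ.erase i, pubReach β σ j (G.pub h)) *
      (G.chance h * ∏ j ∈ univ.erase i, (leafPBS S β σ (G.pub h)).range j (G.info j h)) := by
  rw [cfReach, prod_congr rfl fun j _ => hβ.reach_eq S σ j (info_mem_infostates hh j),
    prod_mul_distrib]
  ring

theorem PBS.Valid.prod_pubReach_le (hG : G.WellFormed) {β : PBS A Opriv Opub} (hβ : β.Valid)
    (σ : ∀ i, G.Policy i) (i : Fin 2) (p : List Opub) :
    ∏ j ∈ univ.erase i, pubReach β σ j p ≤ G.numHist := by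
  refine (prod_le_prod (fun j _ => hβ.pubReach_nonneg σ j p)
    fun j _ => hβ.pubReach_le hG σ j p).trans ?_
  simp

/-- The PBSs that occur in the run of the algorithm. -/
def Reachable (S : G.Search) (β : PBS A Opriv Opub) : Prop :=
  Relation.ReflTransGen (IsLeafPBS S) initialPBS β

theorem Reachable.valid {S : G.Search} {β : PBS A Opriv Opub} (hβ : Reachable S β) :
    β.Valid := by
  induction hβ with
  | refl =>
    intro i s
    simp only [initialPBS]
    split_ifs <;> simp
  | tail _ h ih =>
    obtain ⟨t, -, h, -, -, -, -, rfl⟩ := h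
    exact ih.leafPBS_valid S _ _

/-- The regret-matching iterates at a leaf lead to a PBS of the run, for which the network has been
trained. -/
theorem Reachable.isLeafPBS {S : G.Search} {β : PBS A Opriv Opub} {t : ℕ}
    (ht : t ≤ S.T) {n : ℕ} {h : List ((∀ i, A i) × W)} (hh : h ∈ G.hist n)
    (hn : n = β.pub.length + S.depth β.pub) (hp : β.pub <:+ G.pub h) (hT : ¬ G.Terminal h)
    {i : Fin 2} (hc : 0 < G.cfReach β (iterate S β t) i h) :
    IsLeafPBS S β (leafPBS S β (iterate S β t) (G.pub h)) :=
  ⟨t, ht, h, hn ▸ hh, hp, hT, ⟨i, hc⟩, rfl⟩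

theorem PBS.Valid.rootWeight_nonneg {β : PBS A Opriv Opub} (hβ : β.Valid) (i : Fin 2)
    (s : List (A i × Opriv i × Opub)) : 0 ≤ G.rootWeight β i s :=
  sum_nonneg fun h _ => mul_nonneg (chance_nonneg h) (prod_nonneg fun j _ => (hβ j _).1)

theorem PBS.Valid.rootWeight_le (hG : G.WellFormed) {β : PBS A Opriv Opub} (hβ : β.Valid)
    (i : Fin 2) (s : List (A i × Opriv i × Opub)) : G.rootWeight β i s ≤ G.numHist := by
  refine (sum_le_card_nsmul _ _ 1 fun h _ => ?_).trans ?_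
  · exact mul_le_one₀ (chance_le_one h) (prod_nonneg fun j _ => (hβ j _).1)
      (prod_le_one (fun j _ => (hβ j _).1) fun j _ => (hβ j _).2)
  · simpa using hG.card_histOf_le i s

/-- The weight of a root history among those with the same infostate of agent `i`. -/
def histWeight (G : FOG W A Opriv Opub) (β : PBS A Opriv Opub) (i : Fin 2)
    (h : List ((∀ i, A i) × W)) : ℝ :=
  G.chance h * ∏ j ∈ univ.erase i, β.range j (G.info j h)

theorem PBS.Valid.histWeight_nonneg {β : PBS A Opriv Opub} (hβ : β.Valid) (i : Fin 2)
    (h : List ((∀ i, A i) × W)) : 0 ≤ G.histWeight β i h :=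
  mul_nonneg (chance_nonneg h) (prod_nonneg fun j _ => (hβ j _).1)

theorem rootWeight_eq (β : PBS A Opriv Opub) (i : Fin 2) (s : List (A i × Opriv i × Opub)) :
    G.rootWeight β i s = ∑ h ∈ G.histOf i s, G.histWeight β i h := rfl

theorem PBS.Valid.rootWeight_pos {β : PBS A Opriv Opub} (hβ : β.Valid) {i : Fin 2}
    {s : List (A i × Opriv i × Opub)} {h : List ((∀ i, A i) × W)} (hh : h ∈ G.histOf i s)
    (hw : 0 < G.histWeight β i h) : 0 < G.rootWeight β i s :=
  hw.trans_le (single_le_sum (f := G.histWeight β i) (fun h _ => hβ.histWeight_nonneg i h) hh)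

theorem PBS.Valid.histWeight_eq_zero {β : PBS A Opriv Opub} (hβ : β.Valid) {i : Fin 2}
    {s : List (A i × Opriv i × Opub)} (h0 : G.rootWeight β i s = 0) {h : List ((∀ i, A i) × W)}
    (hh : h ∈ G.histOf i s) : G.histWeight β i h = 0 :=
  (sum_eq_zero_iff_of_nonneg fun h _ => hβ.histWeight_nonneg i h).1 h0 h hh

/-- The weights `1 / (t + 1)` of the running average unroll to the plain mean over `n + 1` iterates.
-/
theorem trainingValue_eq (S : G.Search) (β : PBS A Opriv Opub) (i : Fin 2)
    (s : List (A i × Opriv i × Opub)) (n : ℕ) :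
    trainingValue S β i s n =
      (∑ t ∈ range (n + 1), rootValue S β (iterate S β t) i s) / (n + 1) := by
  induction n with
  | zero => simp [trainingValue]
  | succ n ih =>
    rw [trainingValue, ih, sum_range_succ _ (n + 1)]
    have : (n : ℝ) + 1 + 1 ≠ 0 := by positivity
    have : (n : ℝ) + 2 ≠ 0 := by positivity
    push_cast
    field_simp
    ring

end Beliefs

/-! ### Values: unfolding, linearity, zero sum -/

section Values

variable {G : FOG W A Opriv Opub}

theorem sum_jointProb (hG : G.WellFormed) (σ : ∀ i, G.Policy i) {n : ℕ}
    {h : List ((∀ i, A i) × W)} (hh : h ∈ G.hist n) (hT : ¬ G.Terminal h) :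
    ∑ a : (∀ i, A i), ∏ j, (σ j).prob (G.info j h) (a j) = 1 := by
  have := prod_univ_sum (fun j => (univ : Finset (A j))) fun j b => (σ j).prob (G.info j h) b
  rw [Fintype.piFinset_univ] at this
  rw [← this]
  refine prod_eq_one fun j _ => (σ j).sum_eq_one _ ?_
  rw [nonempty_iff_ne_empty, ne_eq, ← hG.terminal_iff_legalAt hh j]
  exact hT

theorem Policy.legal_of_prob_ne_zero (hG : G.WellFormed) {j : Fin 2} (σ : G.Policy j) {n : ℕ}
    {h : List ((∀ i, A i) × W)} (hh : h ∈ G.hist n) {b : A j}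
    (hb : σ.prob (G.info j h) b ≠ 0) : b ∈ G.legal j (G.world h) := by
  rw [← hG.legalAt_info hh]
  by_contra hn
  exact hb (σ.supp _ _ hn)

/-- Lets sums over all actions and successor states be restricted to the game tree. -/
theorem jointProb_mul_trans_eq_zero (hG : G.WellFormed) (σ : ∀ i, G.Policy i) {n : ℕ}
    {h : List ((∀ i, A i) × W)} (hh : h ∈ G.hist n) {a : ∀ i, A i} {w : W}
    (hn : (a, w) :: h ∉ G.hist (n + 1)) :
    (∏ j, (σ j).prob (G.info j h) (a j)) * G.trans (G.world h) a w = 0 := by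
  by_contra hne
  obtain ⟨h1, h2⟩ := mul_ne_zero_iff.1 hne
  refine hn (cons_mem_hist.2 ⟨hh, fun j => ?_, (G.trans_nonneg _ _ _).lt_of_ne' h2⟩)
  exact (σ j).legal_of_prob_ne_zero hG hh (prod_ne_zero_iff.1 h1 j (mem_univ j))

theorem value_terminal (σ : ∀ i, G.Policy i) (L : List ((∀ i, A i) × W) → ℝ) (i : Fin 2) (n : ℕ)
    {h : List ((∀ i, A i) × W)} (hT : G.Terminal h) : G.value σ L i n h = 0 := by
  cases n <;> simp [value, hT]

theorem value_zero (σ : ∀ i, G.Policy i) (L : List ((∀ i, A i) × W) → ℝ) (i : Fin 2)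
    {h : List ((∀ i, A i) × W)} (hT : ¬ G.Terminal h) : G.value σ L i 0 h = L h := by
  simp [value, hT]

theorem value_succ (σ : ∀ i, G.Policy i) (L : List ((∀ i, A i) × W) → ℝ) (i : Fin 2) (n : ℕ)
    {h : List ((∀ i, A i) × W)} (hT : ¬ G.Terminal h) : G.value σ L i (n + 1) h =
      ∑ a : (∀ i, A i), (∏ j, (σ j).prob (G.info j h) (a j)) * G.reward i (G.world h) a +
      ∑ a : (∀ i, A i), ∑ w, (∏ j, (σ j).prob (G.info j h) (a j)) * G.trans (G.world h) a w *
        G.value σ L i n ((a, w) :: h) := by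
  simp only [value, hT, if_false, mul_add, sum_add_distrib, mul_sum, mul_assoc]

/-- The tower property, which splits a play at the end of its first subgame. -/
theorem value_add_steps (σ : ∀ i, G.Policy i) (L : List ((∀ i, A i) × W) → ℝ) (i : Fin 2)
    (m n : ℕ) (h : List ((∀ i, A i) × W)) :
    G.value σ L i (m + n) h = G.value σ (fun z => G.value σ L i n z) i m h := by
  induction m generalizing h with
  | zero =>
    by_cases hT : G.Terminal h
    · rw [value_terminal _ _ _ _ hT, value_terminal _ _ _ _ hT]
    · rw [value_zero _ _ _ hT, zero_add]
  | succ m ih =>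
    rw [show m + 1 + n = m + n + 1 by ring]
    simp only [value, ih]

theorem value_congr (hG : G.WellFormed) {σ σ' : ∀ i, G.Policy i}
    {L L' : List ((∀ i, A i) × W) → ℝ} (i : Fin 2) {m n : ℕ} {h : List ((∀ i, A i) × W)}
    (hh : h ∈ G.hist n)
    (hσ : ∀ k < m, ∀ z ∈ G.hist (n + k), h <:+ z → ∀ j,
      (σ j).prob (G.info j z) = (σ' j).prob (G.info j z))
    (hL : ∀ z ∈ G.hist (n + m), h <:+ z → ¬ G.Terminal z → L z = L' z) :
    G.value σ L i m h = G.value σ' L' i m h := by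
  induction m generalizing h n with
  | zero =>
    by_cases hT : G.Terminal h
    · rw [value_terminal _ _ _ _ hT, value_terminal _ _ _ _ hT]
    · rw [value_zero _ _ _ hT, value_zero _ _ _ hT, hL h hh List.suffix_rfl hT]
  | succ m ih =>
    by_cases hT : G.Terminal h
    · rw [value_terminal _ _ _ _ hT, value_terminal _ _ _ _ hT]
    have h0 := hσ 0 (by omega) h hh List.suffix_rfl
    rw [value_succ _ _ _ _ hT, value_succ _ _ _ _ hT]
    simp only [h0]
    congr 1
    refine sum_congr rfl fun a _ => sum_congr rfl fun w _ => ?_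
    by_cases hm : (a, w) :: h ∈ G.hist (n + 1)
    · rw [ih hm]
      · intro k hk z hz hs j
        exact hσ (k + 1) (by omega) z (by rwa [show n + (k + 1) = n + 1 + k by ring])
          ((List.suffix_cons _ _).trans hs) j
      · intro z hz hs
        exact hL z (by rwa [show n + (m + 1) = n + 1 + m by ring])
          ((List.suffix_cons _ _).trans hs)
    · rw [jointProb_mul_trans_eq_zero hG σ' hh hm, zero_mul, zero_mul]

/-- With the policies fixed, the value is affine in the leaf values, so randomness that affects only
what happens after the leaves can be averaged there. -/
theorem value_expect {Ω : Type*} [Fintype Ω] [Nonempty Ω] (σ : ∀ i, G.Policy i)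
    (L : Ω → List ((∀ i, A i) × W) → ℝ) (i : Fin 2) (n : ℕ) (h : List ((∀ i, A i) × W)) :
    G.value σ (fun z => Finset.expect univ fun ω => L ω z) i n h =
      Finset.expect univ fun ω => G.value σ (L ω) i n h := by
  induction n generalizing h with
  | zero =>
    by_cases hT : G.Terminal h
    · simp [value_terminal _ _ _ _ hT]
    · simp [value_zero _ _ _ hT]
  | succ n ih =>
    by_cases hT : G.Terminal h
    · simp [value_terminal _ _ _ _ hT]
    · simp only [value_succ _ _ _ _ hT, ih, expect_add_distrib, expect_sum_comm, mul_expect,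
        expect_const univ_nonempty]

theorem sum_filter_apply {i : Fin 2} (F : (∀ i, A i) → ℝ) :
    ∑ b : A i, ∑ a ∈ univ.filter (fun a : ∀ i, A i => a i = b), F a = ∑ a, F a :=
  sum_fiberwise _ _ _

theorem value_eq_sum_actionValue (σ : ∀ i, G.Policy i) (L : List ((∀ i, A i) × W) → ℝ)
    (i : Fin 2) (n : ℕ) {h : List ((∀ i, A i) × W)} (hT : ¬ G.Terminal h) :
    G.value σ L i (n + 1) h =
      ∑ b, (σ i).prob (G.info i h) b * G.actionValue σ L i n h b := by
  simp only [value, hT, if_false, actionValue, mul_sum]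
  rw [← sum_filter_apply (i := i)]
  refine sum_congr rfl fun b _ => sum_congr rfl fun a ha => ?_
  rw [← (mem_filter.1 ha).2, ← mul_prod_erase univ _ (mem_univ i)]
  ring

/-- The deviation changes only agent `i`'s own policy: after a common first action the rewards
cancel and the other agent's probabilities agree. -/
theorem actionValue_sub (σ : ∀ i, G.Policy i) (i : Fin 2) (π : G.Policy i)
    (L L' : List ((∀ i, A i) × W) → ℝ) (n : ℕ) (h : List ((∀ i, A i) × W)) (b : A i) :
    G.actionValue (Function.update σ i π) L i n h b - G.actionValue σ L' i n h b =
      ∑ a ∈ univ.filter (fun a : ∀ i, A i => a i = b), ∑ w,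
        ((∏ j ∈ univ.erase i, (σ j).prob (G.info j h) (a j)) * G.trans (G.world h) a w) *
          (G.value (Function.update σ i π) L i n ((a, w) :: h) - G.value σ L' i n ((a, w) :: h)) := by
  rw [actionValue, actionValue, ← sum_sub_distrib]
  refine sum_congr rfl fun a _ => ?_
  rw [prod_congr rfl fun j hj => by
    rw [Function.update_of_ne (ne_of_mem_erase hj)], ← mul_sub, add_sub_add_left_eq_sub,
    ← sum_sub_distrib, mul_sum]
  refine sum_congr rfl fun w _ => ?_
  ring

theorem value_add_value_succ (σ : ∀ i, G.Policy i) (L : Fin 2 → List ((∀ i, A i) × W) → ℝ) (n : ℕ)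
    {h : List ((∀ i, A i) × W)} (hT : ¬ G.Terminal h) :
    G.value σ (L 0) 0 (n + 1) h + G.value σ (L 1) 1 (n + 1) h =
      ∑ a : (∀ i, A i), ∑ w, (∏ j, (σ j).prob (G.info j h) (a j)) * G.trans (G.world h) a w *
        (G.value σ (L 0) 0 n ((a, w) :: h) + G.value σ (L 1) 1 n ((a, w) :: h)) := by
  rw [value_succ _ _ _ _ hT, value_succ _ _ _ _ hT]
  simp only [mul_add, sum_add_distrib, G.zero_sum, mul_neg, sum_neg_distrib]
  ring

theorem gameValue_add_gameValue (σ : ∀ i, G.Policy i) :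
    G.gameValue σ 0 + G.gameValue σ 1 = 0 := by
  have key : ∀ n h, G.value σ (fun _ => 0) 0 n h + G.value σ (fun _ => 0) 1 n h = 0 := by
    intro n
    induction n with
    | zero => intro h; simp [value]
    | succ n ih =>
      intro h
      by_cases hT : G.Terminal h
      · simp [value_terminal _ _ _ _ hT]
      · rw [value_add_value_succ σ (fun _ _ => 0) n hT]
        simp [ih]
  exact key _ _

/-- A bound for the rewards. -/
def rewardBound (G : FOG W A Opriv Opub) : ℝ :=
  ∑ i : Fin 2, ∑ w, ∑ a : (∀ i, A i), |G.reward i w a|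

theorem rewardBound_nonneg : 0 ≤ G.rewardBound :=
  sum_nonneg fun _ _ => sum_nonneg fun _ _ => sum_nonneg fun _ _ => abs_nonneg _

theorem abs_reward_le (i : Fin 2) (w : W) (a : ∀ i, A i) : |G.reward i w a| ≤ G.rewardBound := by
  refine (single_le_sum (f := fun a => |G.reward i w a|) (fun _ _ => abs_nonneg _)
    (mem_univ a)).trans ?_
  refine (single_le_sum (f := fun w => ∑ a, |G.reward i w a|)
    (fun _ _ => sum_nonneg fun _ _ => abs_nonneg _) (mem_univ w)).trans ?_
  exact single_le_sum (f := fun i => ∑ w, ∑ a, |G.reward i w a|)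
    (fun _ _ => sum_nonneg fun _ _ => sum_nonneg fun _ _ => abs_nonneg _) (mem_univ i)

end Values

/-! ### Uniform bounds for values and regrets -/

section Bounds

variable {G : FOG W A Opriv Opub}

theorem abs_trainingValue_le {S : G.Search} {β : PBS A Opriv Opub} {i : Fin 2}
    {s : List (A i × Opriv i × Opub)} {c : ℝ}
    (h : ∀ t ≤ S.T, |rootValue S β (iterate S β t) i s| ≤ c) :
    |trainingValue S β i s S.T| ≤ c := by
  rw [trainingValue_eq, abs_div, abs_of_pos (by positivity : (0 : ℝ) < S.T + 1),
    div_le_iff₀ (by positivity)]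
  refine (abs_sum_le_sum_abs _ _).trans ((sum_le_card_nsmul _ _ c fun t ht => ?_).trans ?_)
  · exact h t (by simpa [Nat.lt_succ_iff] using ht)
  · simp [mul_comm]

theorem PBS.Valid.abs_rootValue_le {S : G.Search} {β : PBS A Opriv Opub} (hβ : β.Valid)
    {σ : ∀ i, G.Policy i} {i : Fin 2} {s : List (A i × Opriv i × Opub)} {c : ℝ} (hc : 0 ≤ c)
    (h : ∀ h ∈ G.histOf i s, 0 < G.histWeight β i h →
      |G.value σ (leafValue S β σ i) i (S.depth β.pub) h| ≤ c) :
    |rootValue S β σ i s| ≤ c := by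
  have h0 := hβ.rootWeight_nonneg (G := G) i s
  rw [rootValue, abs_div, abs_of_nonneg h0]
  -- A zero root weight makes the quotient zero, hence the need for `0 ≤ c`.
  refine div_le_of_le_mul₀ h0 hc ?_
  refine (abs_sum_le_sum_abs _ _).trans ?_
  rw [rootWeight_eq, mul_sum]
  refine sum_le_sum fun z hz => ?_
  have hn := hβ.histWeight_nonneg (G := G) i z
  change |G.histWeight β i z * _| ≤ _
  rw [abs_mul, abs_of_nonneg hn, mul_comm]
  rcases hn.eq_or_lt with h1 | h1
  · rw [← h1]; simp
  · exact mul_le_mul_of_nonneg_right (h z hz h1) hn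

theorem abs_sum_trans_le {w : W} {a : ∀ i, A i} {v : W → ℝ} {c : ℝ}
    (h : ∀ w', 0 < G.trans w a w' → |v w'| ≤ c) :
    |∑ w', G.trans w a w' * v w'| ≤ c := by
  calc |∑ w', G.trans w a w' * v w'| ≤ ∑ w', G.trans w a w' * c := by
        refine (abs_sum_le_sum_abs _ _).trans (sum_le_sum fun w' _ => ?_)
        have hn := G.trans_nonneg w a w'
        rw [abs_mul, abs_of_nonneg hn]
        rcases hn.eq_or_lt with h1 | h1
        · rw [← h1]; simp
        · exact mul_le_mul_of_nonneg_left (h w' h1) hn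
    _ = c := by rw [← sum_mul, G.trans_sum, one_mul]

theorem abs_stepValue_le {i : Fin 2} {w : W} {a : ∀ i, A i} {v : W → ℝ} {c : ℝ}
    (h : ∀ w', 0 < G.trans w a w' → |v w'| ≤ c) :
    |G.reward i w a + ∑ w', G.trans w a w' * v w'| ≤ G.rewardBound + c :=
  (abs_add_le _ _).trans (add_le_add (abs_reward_le _ _ _) (abs_sum_trans_le h))

theorem abs_value_succ_le (hG : G.WellFormed) {σ : ∀ i, G.Policy i}
    {L : List ((∀ i, A i) × W) → ℝ} {i : Fin 2} {m n : ℕ} {h : List ((∀ i, A i) × W)}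
    (hh : h ∈ G.hist m) (hT : ¬ G.Terminal h) {c : ℝ}
    (hc : ∀ a w, (∀ j, 0 < (σ j).prob (G.info j h) (a j)) → 0 < G.trans (G.world h) a w →
      |G.value σ L i n ((a, w) :: h)| ≤ c) :
    |G.value σ L i (n + 1) h| ≤ G.rewardBound + c := by
  simp only [value, hT, if_false]
  calc _ ≤ ∑ a : (∀ i, A i), (∏ j, (σ j).prob (G.info j h) (a j)) * (G.rewardBound + c) := by
        refine (abs_sum_le_sum_abs _ _).trans (sum_le_sum fun a _ => ?_)
        have hn : 0 ≤ ∏ j, (σ j).prob (G.info j h) (a j) :=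
          prod_nonneg fun j _ => (σ j).nonneg _ _
        rw [abs_mul, abs_of_nonneg hn]
        rcases hn.eq_or_lt with h1 | h1
        · rw [← h1]; simp
        · refine mul_le_mul_of_nonneg_left (abs_stepValue_le fun w' hw' => hc a w' ?_ hw') hn
          intro j
          exact ((σ j).nonneg _ _).lt_of_ne' (prod_ne_zero_iff.1 h1.ne' j (mem_univ j))
    _ = G.rewardBound + c := by rw [← sum_mul, sum_jointProb hG σ hh hT, one_mul]

theorem abs_actionValue_le {σ : ∀ i, G.Policy i}
    {L : List ((∀ i, A i) × W) → ℝ} {i : Fin 2} {n : ℕ} {h : List ((∀ i, A i) × W)} {b : A i}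
    {c : ℝ} (hc0 : 0 ≤ c)
    (hc : ∀ a w, a i = b → (∀ j ∈ univ.erase i, 0 < (σ j).prob (G.info j h) (a j)) →
      0 < G.trans (G.world h) a w → |G.value σ L i n ((a, w) :: h)| ≤ c) :
    |G.actionValue σ L i n h b| ≤ Fintype.card (∀ i, A i) * (G.rewardBound + c) := by
  have hR := rewardBound_nonneg (G := G)
  refine (abs_sum_le_sum_abs _ _).trans
    ((sum_le_card_nsmul _ _ (G.rewardBound + c) fun a ha => ?_).trans ?_)
  · have hn : 0 ≤ ∏ j ∈ univ.erase i, (σ j).prob (G.info j h) (a j) :=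
      prod_nonneg fun j _ => (σ j).nonneg _ _
    rw [abs_mul, abs_of_nonneg hn]
    rcases hn.eq_or_lt with h1 | h1
    · rw [← h1, zero_mul]; positivity
    · refine (mul_le_of_le_one_left (abs_nonneg _) (prod_le_one (fun j _ => (σ j).nonneg _ _)
        fun j _ => (σ j).prob_le_one _ _)).trans ?_
      refine abs_stepValue_le fun w' hw' => hc a w' (mem_filter.1 ha).2 ?_ hw'
      intro j hj
      exact ((σ j).nonneg _ _).lt_of_ne' (prod_ne_zero_iff.1 h1.ne' j hj)
  · rw [nsmul_eq_mul]
    exact mul_le_mul_of_nonneg_right (Nat.cast_le.2 (card_le_univ _)) (by positivity)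

theorem length_le_of_suffix_pub {p : List Opub} {n : ℕ} {h : List ((∀ i, A i) × W)}
    (hh : h ∈ G.hist n) (hp : p <:+ G.pub h) : p.length ≤ n := by
  have := hp.length_le
  rwa [pub_length, length_of_mem_hist hh] at this

theorem suffix_pub_cons {p : List Opub} {h : List ((∀ i, A i) × W)} (hp : p <:+ G.pub h)
    (x : (∀ i, A i) × W) : p <:+ G.pub (x :: h) :=
  hp.trans (List.suffix_cons _ _)

theorem Reachable.leaf {S : G.Search} {β : PBS A Opriv Opub} (hβ : Reachable S β) {t : ℕ}
    (ht : t ≤ S.T) {n : ℕ} {h : List ((∀ i, A i) × W)} (hh : h ∈ G.hist n)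
    (hn : n = β.pub.length + S.depth β.pub) (hp : β.pub <:+ G.pub h) (hT : ¬ G.Terminal h)
    {i : Fin 2} (hc : 0 < G.cfReach β (iterate S β t) i h) :
    Reachable S (leafPBS S β (iterate S β t) (G.pub h)) :=
  hβ.tail (isLeafPBS ht hh hn hp hT hc)

theorem Reachable.histWeight_leaf_pos {S : G.Search} {β : PBS A Opriv Opub}
    (hβ : Reachable S β) (σ : ∀ i, G.Policy i) {n : ℕ} {h : List ((∀ i, A i) × W)}
    (hh : h ∈ G.hist n) {i : Fin 2} (hc : 0 < G.cfReach β σ i h) :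
    0 < G.histWeight (leafPBS S β σ (G.pub h)) i h := by
  rw [hβ.valid.cfReach_eq S _ i hh] at hc
  exact pos_of_mul_pos_right hc (prod_nonneg fun j _ => hβ.valid.pubReach_nonneg _ j _)

/-- At a leaf of the run the network is close to the value it is trained on. -/
theorem Reachable.abs_leafValue_sub_le (hG : G.WellFormed) {S : G.Search} {δ : ℝ}
    (hS : TrainedWithError S δ) {β : PBS A Opriv Opub}
    (hβ : Reachable S β) {t : ℕ}
    (ht : t ≤ S.T) {n : ℕ} {h : List ((∀ i, A i) × W)} (hh : h ∈ G.hist n)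
    (hn : n = β.pub.length + S.depth β.pub) (hp : β.pub <:+ G.pub h) (hT : ¬ G.Terminal h)
    {i : Fin 2} (hc : 0 < G.cfReach β (iterate S β t) i h) :
    |leafValue S β (iterate S β t) i h -
      trainingValue S (leafPBS S β (iterate S β t) (G.pub h)) i (G.info i h) S.T| ≤ δ := by
  refine hS _ (Relation.TransGen.tail' hβ (isLeafPBS ht hh hn hp hT hc)) i _
    (info_mem_infostates hh i) ?_ ?_
  · rw [nonempty_iff_ne_empty, ne_eq, ← hG.terminal_iff_legalAt hh i]
    exact hT
  · exact (hβ.valid.leafPBS_valid S _ _).rootWeight_pos (mem_histOf_info hh)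
      (hβ.histWeight_leaf_pos _ hh hc)

/-- The network is unconstrained outside the run, so values are bounded only at positive
counterfactual reach, by induction on the remaining game and then on the steps left in the subgame.
Each action costs one reward and each leaf crossing costs `δ`; subgames have depth at least one, so
the crossings are charged to actions. The extra `δ` for `n = 0` is a crossing not yet charged. -/
theorem Reachable.abs_value_le_of_steps (hG : G.WellFormed) {S : G.Search} {δ : ℝ} (hδ : 0 ≤ δ)
    (hS : TrainedWithError S δ) (k : ℕ) {β : PBS A Opriv Opub} (hβ : Reachable S β)
    (hk : G.horizon ≤ β.pub.length + k) {t : ℕ} (ht : t ≤ S.T) (i : Fin 2) (n : ℕ) {m : ℕ}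
    {h : List ((∀ i, A i) × W)} (hh : h ∈ G.hist m) (hp : β.pub <:+ G.pub h)
    (hmn : m + n = β.pub.length + S.depth β.pub)
    (hc : 0 < G.cfReach β (iterate S β t) i h) :
    |G.value (iterate S β t) (leafValue S β (iterate S β t) i) i n h| ≤
      (G.horizon - m) * (G.rewardBound + δ) + if n = 0 then δ else 0 := by
  have hR := rewardBound_nonneg (G := G)
  induction k generalizing β t n m h with
  | zero =>
    have h1 := length_le_of_suffix_pub hh hp
    have h2 := hG.le_horizon hh
    have hT : G.Terminal h := by
      by_contra hT
      have := hG.lt_horizon hh hT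
      omega
    rw [value_terminal _ _ _ _ hT, show m = G.horizon by omega]
    split_ifs <;> simp [hδ]
  | succ k ihk =>
    induction n generalizing m h with
    | zero =>
      have hle : (m : ℝ) ≤ G.horizon := Nat.cast_le.2 (hG.le_horizon hh)
      by_cases hT : G.Terminal h
      · rw [value_terminal _ _ _ _ hT, abs_zero]
        have : 0 ≤ (G.horizon : ℝ) - m := by linarith
        simp only [if_true]
        positivity
      rw [value_zero _ _ _ hT]
      simp only [if_true]
      have hm : m = β.pub.length + S.depth β.pub := by omega
      have hd := S.depth_pos β.pub
      -- The search output at the leaf PBS averages root values of a deeper subgame, where the outer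
      -- induction applies with at least one step left and hence without the extra `δ`.
      have key : |trainingValue S (leafPBS S β (iterate S β t) (G.pub h)) i (G.info i h) S.T| ≤
          (G.horizon - m) * (G.rewardBound + δ) := by
        refine abs_trainingValue_le fun t' ht' => ?_
        refine (hβ.valid.leafPBS_valid S _ _).abs_rootValue_le
          (mul_nonneg (by linarith) (by linarith)) fun z hz hw => ?_
        have hz' := mem_histOf.1 hz
        rw [info_length, length_of_mem_hist hh] at hz'
        have hpz : G.pub z = G.pub h := by rw [pub_of_mem_histOf hz, pubOfInfo_info]
        have hl : (leafPBS S β (iterate S β t) (G.pub h)).pub.length = m := by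
          simp [leafPBS, length_of_mem_hist hh]
        have := ihk (hβ.leaf ht hh hm hp hT hc) (by omega) ht'
          (S.depth (leafPBS S β (iterate S β t) (G.pub h)).pub) hz'.1 (by simp [leafPBS, hpz])
          (by omega) (by
            rw [cfReach_of_length_le _ _ _ (by rw [length_of_mem_hist hz'.1, hl])]
            exact hw)
        rwa [if_neg (S.depth_pos _).ne', add_zero] at this
      have h2 := hβ.abs_leafValue_sub_le hG hS ht hh hm hp hT hc
      rw [abs_le] at *
      constructor <;> linarith
    | succ n ihn =>
      have hle : (m : ℝ) ≤ G.horizon := Nat.cast_le.2 (hG.le_horizon hh)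
      simp only [Nat.succ_ne_zero, if_false, add_zero]
      by_cases hT : G.Terminal h
      · rw [value_terminal _ _ _ _ hT, abs_zero]
        exact mul_nonneg (by linarith) (by linarith)
      refine (abs_value_succ_le hG hh hT (c := (G.horizon - ((m + 1 : ℕ) : ℝ)) *
        (G.rewardBound + δ) + δ) fun a w ha hw => ?_).trans (le_of_eq (by push_cast; ring))
      have hm : (a, w) :: h ∈ G.hist (m + 1) := cons_mem_hist.2
        ⟨hh, fun j => Policy.legal_of_prob_ne_zero hG _ hh (ha j).ne', hw⟩
      refine (ihn hm (suffix_pub_cons hp _) (by omega) ?_).trans ?_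
      · rw [cfReach_cons _ _ _ _ _ (by
          rw [length_of_mem_hist hh]; exact length_le_of_suffix_pub hh hp)]
        exact mul_pos hc (mul_pos (prod_pos fun j _ => ha j) hw)
      · split_ifs <;> linarith

/-- A bound for all values in the run, when the network has error at most `δ`. -/
def valueBound (G : FOG W A Opriv Opub) (δ : ℝ) : ℝ := (G.horizon + 1) * (G.rewardBound + δ)

theorem valueBound_nonneg {δ : ℝ} (hδ : 0 ≤ δ) : 0 ≤ G.valueBound δ :=
  mul_nonneg (by positivity) (add_nonneg rewardBound_nonneg hδ)

theorem Reachable.abs_value_le (hG : G.WellFormed) {S : G.Search} {δ : ℝ} (hδ : 0 ≤ δ)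
    (hS : TrainedWithError S δ) {β : PBS A Opriv Opub} (hβ : Reachable S β)
    {t : ℕ} (ht : t ≤ S.T) (i : Fin 2) (n : ℕ) {m : ℕ}
    {h : List ((∀ i, A i) × W)} (hh : h ∈ G.hist m) (hp : β.pub <:+ G.pub h)
    (hmn : m + n = β.pub.length + S.depth β.pub)
    (hc : 0 < G.cfReach β (iterate S β t) i h) :
    |G.value (iterate S β t) (leafValue S β (iterate S β t) i) i n h| ≤ G.valueBound δ := by
  refine (hβ.abs_value_le_of_steps hG hδ hS G.horizon (by omega) ht i n hh hp hmn hc).trans ?_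
  have hR := rewardBound_nonneg (G := G)
  rw [valueBound]
  have : 0 ≤ (m : ℝ) * (G.rewardBound + δ) := by positivity
  split_ifs <;> linarith

/-- Counterfactual reach omits agent `i`'s own probabilities. After a legal `b`, the successors that
carry weight therefore have positive counterfactual reach even if the iterate never plays `b`, and
the value bound applies to them. -/
theorem Reachable.abs_instRegret_le (hG : G.WellFormed) {S : G.Search} {δ : ℝ} (hδ : 0 ≤ δ)
    (hS : TrainedWithError S δ) {β : PBS A Opriv Opub} (hβ : Reachable S β)
    {t : ℕ} (ht : t ≤ S.T) {i : Fin 2} {s : List (A i × Opriv i × Opub)}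
    (hp : β.pub <:+ pubOfInfo s) (hs : s.length < β.pub.length + S.depth β.pub)
    {b : A i} (hb : b ∈ G.legalAt i s) :
    |instRegret S β (iterate S β t) i s b| ≤ G.numHist *
      (Fintype.card (∀ i, A i) * (G.rewardBound + G.valueBound δ) + G.valueBound δ) := by
  have hR := rewardBound_nonneg (G := G)
  have hB := valueBound_nonneg (G := G) hδ
  set c := Fintype.card (∀ i, A i) * (G.rewardBound + G.valueBound δ) + G.valueBound δ with hc
  have hc0 : 0 ≤ c := by positivity
  refine (abs_sum_le_sum_abs _ _).trans ((sum_le_card_nsmul _ _ c fun h hh => ?_).trans ?_)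
  · have hn := hβ.valid.cfReach_nonneg (iterate S β t) i h
    rw [abs_mul, abs_of_nonneg hn]
    rcases hn.eq_or_lt with h1 | h1
    · rw [← h1, zero_mul]; exact hc0
    refine (mul_le_of_le_one_left (abs_nonneg _) (hβ.valid.cfReach_le_one _ _ _)).trans ?_
    have hph : β.pub <:+ G.pub h := by rwa [pub_of_mem_histOf hh]
    have hh' := mem_histOf.1 hh
    have hle := length_le_of_suffix_pub hh'.1 hph
    refine (abs_sub _ _).trans (add_le_add (abs_actionValue_le hB fun a w ha hpos hw => ?_) ?_)
    · have hm : (a, w) :: h ∈ G.hist (s.length + 1) := by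
        refine cons_mem_hist.2 ⟨hh'.1, fun j => ?_, hw⟩
        by_cases hj : j = i
        · subst hj
          rw [← hG.legalAt_info hh'.1, hh'.2, ha]
          exact hb
        · exact Policy.legal_of_prob_ne_zero hG _ hh'.1 (hpos j (by simp [hj])).ne'
      refine hβ.abs_value_le hG hδ hS ht i _ hm (suffix_pub_cons hph _) ?_ ?_
      · rw [stepsLeft]; omega
      · rw [cfReach_cons _ _ _ _ _ (by rw [length_of_mem_hist hh'.1]; exact hle)]
        exact mul_pos h1 (mul_pos (prod_pos hpos) hw)
    · exact hβ.abs_value_le hG hδ hS ht i _ hh'.1 hph (by rw [stepsLeft]; omega) h1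
  · rw [nsmul_eq_mul]
    exact mul_le_mul_of_nonneg_right (hG.card_histOf_le i s) hc0

end Bounds

/-! ### Regret matching and the CFR decomposition -/

section Regret

variable {G : FOG W A Opriv Opub}

theorem nonterminal_of_legalAt_nonempty (hG : G.WellFormed) {i : Fin 2}
    {s : List (A i × Opriv i × Opub)} (hs : (G.legalAt i s).Nonempty)
    {h : List ((∀ i, A i) × W)} (hh : h ∈ G.histOf i s) : ¬ G.Terminal h := by
  obtain ⟨h1, h2⟩ := mem_histOf.1 hh
  rw [hG.terminal_iff_legalAt h1 i, h2]
  exact hs.ne_empty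

/-- The value at `s` is the policy's own average of the action values, so its average regret is
zero. -/
theorem sum_prob_mul_instRegret (hG : G.WellFormed) (S : G.Search) (β : PBS A Opriv Opub)
    (σ : ∀ i, G.Policy i) {i : Fin 2} {s : List (A i × Opriv i × Opub)}
    (hs : s.length < β.pub.length + S.depth β.pub) (hne : (G.legalAt i s).Nonempty) :
    ∑ b, (σ i).prob s b * instRegret S β σ i s b = 0 := by
  obtain ⟨n, hn⟩ : ∃ n, stepsLeft S β s.length = n + 1 :=
    ⟨stepsLeft S β s.length - 1, by simp only [stepsLeft]; omega⟩
  simp only [instRegret, hn, mul_sum, Nat.add_sub_cancel]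
  rw [sum_comm]
  refine sum_eq_zero fun h hh => ?_
  have hT := nonterminal_of_legalAt_nonempty hG hne hh
  have h1 := value_eq_sum_actionValue σ (leafValue S β σ i) i n hT
  rw [(mem_histOf.1 hh).2] at h1
  calc _ = G.cfReach β σ i h *
        (∑ b, (σ i).prob s b * G.actionValue σ (leafValue S β σ i) i n h b -
          (∑ b, (σ i).prob s b) * G.value σ (leafValue S β σ i) i (n + 1) h) := by
        rw [sum_mul, ← sum_sub_distrib, mul_sum]
        exact sum_congr rfl fun b _ => by ring
    _ = 0 := by rw [← h1, (σ i).sum_eq_one s hne, one_mul, sub_self, mul_zero]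

/-- The orthogonality condition of Blackwell's argument: regret matching plays the positive parts up
to normalization. In the uniform case all positive parts vanish and the sum is trivially zero. -/
theorem sum_legal_posPart_mul_eq_zero (i : Fin 2)
    (R : List (A i × Opriv i × Opub) → A i → ℝ) (s : List (A i × Opriv i × Opub)) (r : A i → ℝ)
    (h : ∑ b, (G.regretMatching i R).prob s b * r b = 0) :
    ∑ b ∈ G.legalAt i s, max (R s b) 0 * r b = 0 := by
  by_cases hp : 0 < ∑ b ∈ G.legalAt i s, max (R s b) 0
  · simp only [regretMatching, hp, if_true, ite_mul, zero_mul] at h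
    rw [sum_ite_mem, univ_inter] at h
    simp only [div_mul_eq_mul_div] at h
    rw [← sum_div, div_eq_zero_iff] at h
    exact h.resolve_right hp.ne'
  · have h0 : ∑ b ∈ G.legalAt i s, max (R s b) 0 = 0 :=
      le_antisymm (not_lt.1 hp) (sum_nonneg fun _ _ => le_max_right _ _)
    rw [sum_eq_zero_iff_of_nonneg fun _ _ => le_max_right _ _] at h0
    exact sum_eq_zero fun b hb => by rw [h0 b hb, zero_mul]

theorem sq_max_add_le (x r : ℝ) : max (x + r) 0 ^ 2 ≤ max x 0 ^ 2 + 2 * (max x 0 * r) + r ^ 2 := by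
  have h1 : max (x + r) 0 ≤ |max x 0 + r| :=
    max_le ((add_le_add_left (le_max_left x 0) r).trans (le_abs_self _)) (abs_nonneg _)
  calc max (x + r) 0 ^ 2 ≤ |max x 0 + r| ^ 2 := pow_le_pow_left₀ (le_max_right _ _) h1 2
    _ = _ := by rw [sq_abs]; ring

/-- Blackwell's argument: regret matching keeps the positive regrets of order `√T`. -/
theorem sum_sq_cumRegret_le (hG : G.WellFormed) (S : G.Search) (β : PBS A Opriv Opub)
    {i : Fin 2} {s : List (A i × Opriv i × Opub)}
    (hs : s.length < β.pub.length + S.depth β.pub) {D : ℝ} (n : ℕ)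
    (hD : ∀ t < n, ∀ b ∈ G.legalAt i s, |instRegret S β (iterate S β t) i s b| ≤ D) :
    ∑ b ∈ G.legalAt i s, max (cumRegret S β n i s b) 0 ^ 2 ≤
      n * ((G.legalAt i s).card * D ^ 2) := by
  induction n with
  | zero => simp [cumRegret]
  | succ n ih =>
    rcases (G.legalAt i s).eq_empty_or_nonempty with he | hne
    · simp [he]
    have h0 := sum_legal_posPart_mul_eq_zero i (cumRegret S β n i) s _
      (sum_prob_mul_instRegret hG S β (iterate S β n) hs hne)
    calc ∑ b ∈ G.legalAt i s, max (cumRegret S β (n + 1) i s b) 0 ^ 2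
        ≤ ∑ b ∈ G.legalAt i s, (max (cumRegret S β n i s b) 0 ^ 2 +
            2 * (max (cumRegret S β n i s b) 0 * instRegret S β (iterate S β n) i s b) +
            instRegret S β (iterate S β n) i s b ^ 2) := sum_le_sum fun b _ => sq_max_add_le _ _
      _ = ∑ b ∈ G.legalAt i s, max (cumRegret S β n i s b) 0 ^ 2 +
            ∑ b ∈ G.legalAt i s, instRegret S β (iterate S β n) i s b ^ 2 := by
          rw [sum_add_distrib, sum_add_distrib, ← mul_sum, h0, mul_zero, add_zero]
      _ ≤ n * ((G.legalAt i s).card * D ^ 2) + (G.legalAt i s).card * D ^ 2 := by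
          refine add_le_add (ih fun t ht => hD t (by omega)) ?_
          rw [← nsmul_eq_mul]
          refine sum_le_card_nsmul _ _ _ fun b hb => ?_
          rw [← sq_abs]
          exact pow_le_pow_left₀ (abs_nonneg _) (hD n (by omega) b hb) 2
      _ = _ := by push_cast; ring

theorem cumRegret_le (hG : G.WellFormed) (S : G.Search) (β : PBS A Opriv Opub)
    {i : Fin 2} {s : List (A i × Opriv i × Opub)}
    (hs : s.length < β.pub.length + S.depth β.pub) {D : ℝ} (hD0 : 0 ≤ D) (n : ℕ)
    (hD : ∀ t < n, ∀ b ∈ G.legalAt i s, |instRegret S β (iterate S β t) i s b| ≤ D) {b : A i}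
    (hb : b ∈ G.legalAt i s) :
    cumRegret S β n i s b ≤ √n * (Fintype.card (A i) * D) := by
  refine (le_max_left _ 0).trans (le_of_sq_le_sq ?_ (by positivity))
  have h1 := (single_le_sum (f := fun b => max (cumRegret S β n i s b) 0 ^ 2)
    (fun _ _ => sq_nonneg _) hb).trans (sum_sq_cumRegret_le hG S β hs n hD)
  refine h1.trans ?_
  rw [mul_pow, Real.sq_sqrt (Nat.cast_nonneg n), mul_pow]
  refine mul_le_mul_of_nonneg_left (mul_le_mul_of_nonneg_right ?_ (sq_nonneg _)) (by positivity)
  have h2 : (G.legalAt i s).card ≤ Fintype.card (A i) := card_le_univ _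
  -- The square root of the number of actions is replaced by the number itself to keep the constant
  -- simple.
  have h3 : Fintype.card (A i) ≤ Fintype.card (A i) ^ 2 := Nat.le_self_pow two_ne_zero _
  exact_mod_cast h2.trans h3

theorem cumRegret_eq_sum (S : G.Search) (β : PBS A Opriv Opub) (i : Fin 2)
    (s : List (A i × Opriv i × Opub)) (b : A i) (n : ℕ) :
    cumRegret S β n i s b = ∑ t ∈ range n, instRegret S β (iterate S β t) i s b := by
  induction n with
  | zero => rfl
  | succ n ih => rw [sum_range_succ, ← ih]; rfl

/-- The counterfactual advantage at `s` of deviating to `π`, and getting `L` at the leaves. -/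
def cfGain {G : FOG W A Opriv Opub} (S : G.Search) (β : PBS A Opriv Opub) (σ : ∀ i, G.Policy i)
    (i : Fin 2) (π : G.Policy i) (L : List ((∀ i, A i) × W) → ℝ) (n : ℕ)
    (s : List (A i × Opriv i × Opub)) : ℝ :=
  ∑ h ∈ G.histOf i s, G.cfReach β σ i h *
    (G.value (Function.update σ i π) L i n h - G.value σ (leafValue S β σ i) i n h)

/-- Each action's gain telescopes: first switch to `b` and then follow the iterate (the
instantaneous regret), then switch the continuation (the gain at the children). Agent `i`'s own
probabilities are absent from `cfReach`, so its weights pass to the children with no factor for `b`.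
The same `π` serves all iterations, so summing over `t` later turns the regrets into cumulative
ones. -/
theorem cfGain_succ (hG : G.WellFormed) (S : G.Search) {β : PBS A Opriv Opub}
    (σ : ∀ i, G.Policy i) (i : Fin 2) (π : G.Policy i) (L : List ((∀ i, A i) × W) → ℝ) (n : ℕ)
    {s : List (A i × Opriv i × Opub)} (hl : β.pub.length ≤ s.length)
    (hn : stepsLeft S β s.length = n + 1) (hne : (G.legalAt i s).Nonempty) :
    cfGain S β σ i π L (n + 1) s = ∑ b, π.prob s b *
      (instRegret S β σ i s b + ∑ s' ∈ G.children i s b, cfGain S β σ i π L n s') := by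
  have step : ∀ b ∈ G.legalAt i s, ∑ s' ∈ G.children i s b, cfGain S β σ i π L n s' =
      ∑ h ∈ G.histOf i s, G.cfReach β σ i h *
        (G.actionValue (Function.update σ i π) L i n h b -
          G.actionValue σ (leafValue S β σ i) i n h b) := by
    intro b hb
    simp only [cfGain]
    rw [← sum_children i s b]
    · refine sum_congr rfl fun h hh => ?_
      have hlen : β.pub.length ≤ h.length := by rwa [length_of_mem_hist (mem_histOf.1 hh).1]
      rw [actionValue_sub, mul_sum]
      refine sum_congr rfl fun a _ => ?_
      rw [mul_sum]
      refine sum_congr rfl fun w _ => ?_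
      rw [cfReach_cons _ _ _ _ _ hlen]
      ring
    · intro h hh a w ha hm
      obtain ⟨h1, h2⟩ := mem_histOf.1 hh
      have hlen : β.pub.length ≤ h.length := by rwa [length_of_mem_hist h1]
      refine mul_eq_zero_of_left ?_ _
      rw [cfReach_cons _ _ _ _ _ hlen]
      refine mul_eq_zero_of_right _ ?_
      by_contra h3
      obtain ⟨h4, h5⟩ := mul_ne_zero_iff.1 h3
      refine hm (cons_mem_hist.2 ⟨h1, fun j => ?_, (G.trans_nonneg _ _ _).lt_of_ne' h5⟩)
      by_cases hj : j = i
      · subst hj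
        rw [← hG.legalAt_info h1, h2, ha]
        exact hb
      · exact Policy.legal_of_prob_ne_zero hG _ h1
          (prod_ne_zero_iff.1 h4 j (mem_erase.2 ⟨hj, mem_univ _⟩))
  have step2 : ∀ b, π.prob s b *
      (instRegret S β σ i s b + ∑ s' ∈ G.children i s b, cfGain S β σ i π L n s') =
      ∑ h ∈ G.histOf i s, G.cfReach β σ i h *
        (π.prob s b * G.actionValue (Function.update σ i π) L i n h b -
          π.prob s b * G.value σ (leafValue S β σ i) i (n + 1) h) := by
    intro b
    by_cases hb : b ∈ G.legalAt i s
    · rw [step b hb, instRegret, hn, ← sum_add_distrib, mul_sum]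
      refine sum_congr rfl fun h _ => ?_
      rw [Nat.add_sub_cancel]
      ring
    · simp [π.supp s b hb]
  simp only [step2]
  rw [sum_comm]
  refine sum_congr rfl fun h hh => ?_
  rw [← mul_sum, sum_sub_distrib, ← sum_mul, π.sum_eq_one s hne, one_mul,
    value_eq_sum_actionValue _ _ _ _ (nonterminal_of_legalAt_nonempty hG hne hh),
    (mem_histOf.1 hh).2]
  simp

theorem cfGain_eq_zero (S : G.Search) {β : PBS A Opriv Opub} (σ : ∀ i, G.Policy i) {i : Fin 2}
    (π : G.Policy i) (L : List ((∀ i, A i) × W) → ℝ) (n : ℕ) {s : List (A i × Opriv i × Opub)}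
    (hT : ∀ h ∈ G.histOf i s, G.Terminal h) : cfGain S β σ i π L n s = 0 :=
  sum_eq_zero fun h hh => by simp [value_terminal _ _ _ _ (hT h hh)]

/-- The regret bounds at all infostates of the subgame bound the gain from any deviation. -/
theorem sum_cfGain_le (hG : G.WellFormed) (S : G.Search) {β : PBS A Opriv Opub} {i : Fin 2}
    (π : G.Policy i) (L : ℕ → List ((∀ i, A i) × W) → ℝ) {X : ℝ} (hX : 0 ≤ X)
    (hreg : ∀ s, β.pub <:+ pubOfInfo s → s.length < β.pub.length + S.depth β.pub →
      ∀ b ∈ G.legalAt i s, cumRegret S β S.T i s b ≤ X)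
    (hleaf : ∀ s, β.pub <:+ pubOfInfo s → s.length = β.pub.length + S.depth β.pub →
      (∀ h ∈ G.histOf i s, ¬ G.Terminal h) →
      ∑ t ∈ range S.T, ∑ h ∈ G.histOf i s, G.cfReach β (iterate S β t) i h *
        (L t h - leafValue S β (iterate S β t) i h) ≤ X)
    (n k : ℕ) {s : List (A i × Opriv i × Opub)} (hp : β.pub <:+ pubOfInfo s)
    (hn : s.length + n = β.pub.length + S.depth β.pub) (hk : G.horizon ≤ s.length + k) :
    ∑ t ∈ range S.T, cfGain S β (iterate S β t) i π (L t) n s ≤ (1 + G.numHist) ^ k * X := by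
  have hN : 0 ≤ G.numHist := zero_le_one.trans hG.one_le_numHist
  have hX' : X ≤ (1 + G.numHist) ^ k * X :=
    le_mul_of_one_le_left hX (one_le_pow₀ (by linarith))
  induction n generalizing s k with
  | zero =>
    by_cases hall : ∀ h ∈ G.histOf i s, G.Terminal h
    · rw [sum_eq_zero fun t _ => cfGain_eq_zero S _ π _ _ hall]
      positivity
    push Not at hall
    obtain ⟨h, hh, hT⟩ := hall
    have hnT : ∀ h ∈ G.histOf i s, ¬ G.Terminal h := fun h' hh' hT' =>
      hT (hG.terminal_congr hh' hh hT')
    refine le_trans (le_of_eq ?_) ((hleaf s hp (by omega) hnT).trans hX')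
    refine sum_congr rfl fun t _ => sum_congr rfl fun z hz => ?_
    rw [value_zero _ _ _ (hnT z hz), value_zero _ _ _ (hnT z hz)]
  | succ n ih =>
    by_cases hall : ∀ h ∈ G.histOf i s, G.Terminal h
    · rw [sum_eq_zero fun t _ => cfGain_eq_zero S _ π _ _ hall]
      positivity
    push Not at hall
    obtain ⟨h, hh, hT⟩ := hall
    have hl : β.pub.length ≤ s.length := by simpa [pubOfInfo] using hp.length_le
    have hlt := hG.lt_horizon (mem_histOf.1 hh).1 hT
    -- At a nonterminal infostate part of the horizon is left. The exponent counts remaining actions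
    -- of the game and not of the subgame, which keeps the bound independent of the search depth.
    obtain ⟨k, rfl⟩ : ∃ k', k = k' + 1 := ⟨k - 1, by omega⟩
    have hne : (G.legalAt i s).Nonempty := by
      rw [nonempty_iff_ne_empty, ne_eq, ← (mem_histOf.1 hh).2,
        ← hG.terminal_iff_legalAt (mem_histOf.1 hh).1]
      exact hT
    have hchild : ∀ b, ∀ s' ∈ G.children i s b,
        ∑ t ∈ range S.T, cfGain S β (iterate S β t) i π (L t) n s' ≤
          (1 + G.numHist) ^ k * X := by
      intro b s' hs'
      obtain ⟨o, rfl⟩ := (mem_filter.1 hs').2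
      have hp' : β.pub <:+ pubOfInfo ((b, o) :: s) := hp.trans (List.suffix_cons _ _)
      exact ih k hp' (by simp only [List.length_cons]; omega)
        (by simp only [List.length_cons]; omega)
        (le_mul_of_one_le_left hX (one_le_pow₀ (by linarith)))
    calc ∑ t ∈ range S.T, cfGain S β (iterate S β t) i π (L t) (n + 1) s
        = ∑ b, π.prob s b * (cumRegret S β S.T i s b + ∑ s' ∈ G.children i s b,
            ∑ t ∈ range S.T, cfGain S β (iterate S β t) i π (L t) n s') := by
          rw [sum_congr rfl fun t _ => cfGain_succ hG S (iterate S β t) i π (L t) n hl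
            (by simp only [stepsLeft]; omega) hne, sum_comm]
          refine sum_congr rfl fun b _ => ?_
          rw [← mul_sum, sum_add_distrib, cumRegret_eq_sum, sum_comm (s := range S.T)]
      _ ≤ ∑ b, π.prob s b * (X + G.numHist * ((1 + G.numHist) ^ k * X)) := by
          refine sum_le_sum fun b _ => ?_
          by_cases hb : b ∈ G.legalAt i s
          · refine mul_le_mul_of_nonneg_left (add_le_add (hreg s hp (by omega) b hb) ?_)
              (π.nonneg _ _)
            refine (sum_le_card_nsmul _ _ _ (hchild b)).trans ?_
            rw [nsmul_eq_mul]
            exact mul_le_mul_of_nonneg_right (hG.card_children_le i s b) (by positivity)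
          · simp [π.supp s b hb]
      _ = X + G.numHist * ((1 + G.numHist) ^ k * X) := by
          rw [← sum_mul, π.sum_eq_one s hne, one_mul]
      _ ≤ (1 + G.numHist) ^ (k + 1) * X := by
          have := mul_le_mul_of_nonneg_right
            (one_le_pow₀ (n := k) (by linarith : 1 ≤ 1 + G.numHist)) hX
          rw [pow_succ]
          nlinarith

end Regret

/-! ### Test-time play as a recursion over subgames -/

section TestPlay

variable {G : FOG W A Opriv Opub}

instance (S : G.Search) : Nonempty (Fin S.T) := ⟨⟨0, S.T_pos⟩⟩

/-- Resampling one coordinate of a uniform tuple does not change its law. -/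
theorem expect_apply_update {ι κ : Type*} [Fintype ι] [DecidableEq ι] [Fintype κ] [Nonempty κ] (k : ι)
    (F : (ι → κ) → ℝ) :
    Finset.expect univ F =
      Finset.expect univ fun ω => Finset.expect univ fun t => F (Function.update ω k t) := by
  -- Exchanging the fresh value with the old coordinate is an involution.
  let e : (ι → κ) × κ ≃ (ι → κ) × κ :=
    { toFun := fun x => (Function.update x.1 k x.2, x.1 k)
      invFun := fun x => (Function.update x.1 k x.2, x.1 k)
      left_inv := fun x => by simp
      right_inv := fun x => by simp }
  have h1 := expect_product' (univ : Finset (ι → κ)) (univ : Finset κ)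
    fun ω t => F (Function.update ω k t)
  have h2 := expect_product' (univ : Finset (ι → κ)) (univ : Finset κ) fun ω _ => F ω
  rw [← h1]
  simp only [expect_const univ_nonempty] at h2
  rw [← h2, univ_product_univ]
  exact (Fintype.expect_equiv e _ _ fun x => rfl).symm

theorem pub_suffix {h z : List ((∀ i, A i) × W)} (hz : h <:+ z) : G.pub h <:+ G.pub z := by
  induction z with
  | nil => rw [List.suffix_nil.1 hz]
  | cons x z ih =>
    rcases List.suffix_cons_iff.1 hz with rfl | h1
    · exact List.suffix_rfl
    · exact (ih h1).trans (List.suffix_cons _ _)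

theorem current_append (S : G.Search) (ω : Seed S) {p : List Opub} {β : PBS A Opriv Opub} {m : ℕ}
    (h : current S ω p = (β, m)) (q : List Opub) (hq : q.length < m) :
    current S ω (q ++ p) = (β, m - q.length) := by
  induction q with
  | nil => simpa using h
  | cons o q ih =>
    simp only [List.length_cons] at hq
    have := ih (by omega)
    rw [List.cons_append, current, this, if_neg (by simp only; omega)]
    simp [Nat.sub_sub]

theorem current_append_leaf (S : G.Search) (ω : Seed S) {p : List Opub} {β : PBS A Opriv Opub}
    {m : ℕ} (hm : 0 < m) (h : current S ω p = (β, m)) (q : List Opub) (hq : q.length = m) :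
    current S ω (q ++ p) =
      (leafPBS S β (iterate S β (drawn S ω β.pub.length)) (q ++ p), S.depth (q ++ p)) := by
  cases q with
  | nil => simp at hq; omega
  | cons o q =>
    simp only [List.length_cons] at hq
    rw [List.cons_append, current, current_append S ω h q (by omega), if_pos (by simp only; omega)]

/-- Steps beyond the horizon add nothing. This allows a subgame that is deeper than the rest of the
game to be split off like any other. -/
theorem value_zero_leaf_congr (hG : G.WellFormed) (σ : ∀ i, G.Policy i) (i : Fin 2) {m n k : ℕ}
    {h : List ((∀ i, A i) × W)} (hh : h ∈ G.hist m) (hn : G.horizon ≤ m + n) :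
    G.value σ (fun _ => 0) i (n + k) h = G.value σ (fun _ => 0) i n h := by
  rw [value_add_steps]
  refine value_congr hG i hh (fun _ _ _ _ _ _ => rfl) fun z hz _ hT => ?_
  have := hG.lt_horizon hz hT
  omega

/-- The value for agent `i` of playing `π` from `h` on, in at most `n` subgames of which the first
is rooted at `β`, when the other agent uses the seed `ω`. -/
def seededValue {G : FOG W A Opriv Opub} (S : G.Search) (i : Fin 2) (π : G.Policy i)
    (ω : Seed S) : ℕ → PBS A Opriv Opub → List ((∀ i, A i) × W) → ℝ
  | 0, _, _ => 0
  | n + 1, β, h => G.value (Function.update (iterate S β (drawn S ω β.pub.length)) i π)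
      (fun z => seededValue S i π ω n
        (leafPBS S β (iterate S β (drawn S ω β.pub.length)) (G.pub z)) z) i (S.depth β.pub) h

/-- The expectation of `seededValue` over the seed. -/
def deviationValue {G : FOG W A Opriv Opub} (S : G.Search) (i : Fin 2) (π : G.Policy i) :
    ℕ → PBS A Opriv Opub → List ((∀ i, A i) × W) → ℝ
  | 0, _, _ => 0
  | n + 1, β, h => Finset.expect univ fun t : Fin S.T =>
      G.value (Function.update (iterate S β t) i π)
        (fun z => deviationValue S i π n (leafPBS S β (iterate S β t) (G.pub z)) z) i
        (S.depth β.pub) h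

/-- The other agent tracks its PBS from public observations and its own seed alone, so the deviation
of agent `i` does not affect which subgames it solves. As each subgame lasts at least one action,
`n` subgames cover the remaining `n` actions. -/
theorem value_testPolicy_eq (hG : G.WellFormed) (S : G.Search) (i : Fin 2) (π : G.Policy i)
    (ω : Fin 2 → Seed S) {ω' : Seed S} (hω : ∀ j, j ≠ i → ω j = ω') (n : ℕ)
    {β : PBS A Opriv Opub} {m N : ℕ} {h : List ((∀ i, A i) × W)} (hh : h ∈ G.hist m)
    (hβ : β.pub = G.pub h) (hc : current S ω' (G.pub h) = (β, S.depth β.pub))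
    (hn : G.horizon ≤ m + n) (hN : G.horizon ≤ m + N) :
    G.value (Function.update (fun j => testPolicy S j (ω j)) i π) (fun _ => 0) i N h =
      seededValue S i π ω' n β h := by
  induction n generalizing β m N h with
  | zero =>
    have := hG.le_horizon hh
    rw [value_terminal _ _ _ _ (hG.ends h (by rwa [show G.horizon = m by omega]))]
    rfl
  | succ n ih =>
    -- The number of steps is padded by the depth, so that the first subgame can be split off and
    -- `N` steps remain.
    rw [← value_zero_leaf_congr hG _ i (k := S.depth β.pub) hh hN, add_comm N, value_add_steps,
      seededValue]
    have hd := S.depth_pos β.pub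
    refine value_congr hG i hh (fun k hk z hz hs j => ?_) fun z hz hs _ => ?_
    · by_cases hj : j = i
      · subst hj; simp
      obtain ⟨q, hq⟩ := pub_suffix (G := G) hs
      have hql : q.length = k := by
        have := congrArg List.length hq
        simp only [List.length_append, pub_length, length_of_mem_hist hz,
          length_of_mem_hist hh] at this
        omega
      have hcur := current_append S ω' hc q (by omega)
      rw [hq] at hcur
      rw [Function.update_of_ne hj, Function.update_of_ne hj]
      simp only [testPolicy, pubOfInfo_info, hω j hj, hcur]
    · obtain ⟨q, hq⟩ := pub_suffix (G := G) hs
      have hql : q.length = S.depth β.pub := by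
        have := congrArg List.length hq
        simp only [List.length_append, pub_length, length_of_mem_hist hz,
          length_of_mem_hist hh] at this
        omega
      have hcur := current_append_leaf S ω' hd hc q hql
      rw [hq] at hcur
      exact ih hz rfl hcur (by omega) (by omega)

theorem drawn_congr (S : G.Search) {ω ω' : Seed S} {n k : ℕ}
    (h : ∀ l : Fin G.horizon, n ≤ l → ω l = ω' l) (hk : n ≤ k) :
    drawn S ω k = drawn S ω' k := by
  unfold drawn
  split_ifs with h1
  · rw [h _ hk]
  · rfl

/-- Play from `h` on reads only the seed entries from its length on; earlier draws enter solely
through `β`. -/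
theorem seededValue_congr (hG : G.WellFormed) (S : G.Search) (i : Fin 2) (π : G.Policy i)
    {ω ω' : Seed S} (n : ℕ) {β : PBS A Opriv Opub} {m : ℕ} {h : List ((∀ i, A i) × W)}
    (hh : h ∈ G.hist m) (hm : β.pub.length = m)
    (hω : ∀ l : Fin G.horizon, m ≤ l → ω l = ω' l) :
    seededValue S i π ω n β h = seededValue S i π ω' n β h := by
  induction n generalizing β m h with
  | zero => rfl
  | succ n ih =>
    rw [seededValue, seededValue, drawn_congr S hω hm.ge]
    refine value_congr hG i hh (fun _ _ _ _ _ _ => rfl) fun z hz _ _ => ?_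
    exact ih hz (by simp [leafPBS, length_of_mem_hist hz]) fun l hl => hω l (by omega)

theorem expect_seededValue (hG : G.WellFormed) (S : G.Search) (i : Fin 2) (π : G.Policy i) (n : ℕ)
    {β : PBS A Opriv Opub} {m : ℕ} {h : List ((∀ i, A i) × W)} (hh : h ∈ G.hist m)
    (hm : β.pub.length = m) :
    (Finset.expect univ fun ω : Seed S => seededValue S i π ω n β h) =
      deviationValue S i π n β h := by
  induction n generalizing β m h with
  | zero => simp [seededValue, deviationValue]
  | succ n ih =>
    -- Only a nonterminal root is sure to have length below the horizon, as the index of a seed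
    -- entry requires.
    by_cases hT : G.Terminal h
    · simp [seededValue, deviationValue, value_terminal _ _ _ _ hT]
    have hlt := hG.lt_horizon hh hT
    have hd := S.depth_pos β.pub
    rw [expect_apply_update (⟨m, hlt⟩ : Fin G.horizon), expect_comm, deviationValue]
    refine expect_congr rfl fun t _ => ?_
    have h1 : ∀ ω : Seed S, drawn S (Function.update ω ⟨m, hlt⟩ t) β.pub.length = t := by
      intro ω
      subst hm
      simp [drawn, hlt]
    simp only [seededValue, h1]
    -- Once the current draw is fixed to `t`, the seed matters only beyond the leaves, where later
    -- entries are read and resetting this one is harmless.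
    rw [← value_expect]
    refine value_congr hG i hh (fun _ _ _ _ _ _ => rfl) fun z hz _ _ => ?_
    have hl : (leafPBS S β (iterate S β t) (G.pub z)).pub.length = m + S.depth β.pub := by
      simp [leafPBS, length_of_mem_hist hz]
    rw [← ih hz hl]
    refine expect_congr rfl fun ω _ => seededValue_congr hG S i π n hz hl fun l hl' => ?_
    rw [Function.update_of_ne]
    rintro rfl
    simp only at hl'
    omega

theorem gameValue_testPolicy_eq (hG : G.WellFormed) (S : G.Search) (i : Fin 2) (π : G.Policy i)
    (ω : Fin 2 → Seed S) {ω' : Seed S} (hω : ∀ j, j ≠ i → ω j = ω') :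
    G.gameValue (Function.update (fun j => testPolicy S j (ω j)) i π) i =
      seededValue S i π ω' G.horizon initialPBS [] :=
  value_testPolicy_eq hG S i π ω hω G.horizon (m := 0) (by simp [hist]) rfl rfl (by omega)
    (by omega)

theorem expect_pair {X : Type*} [Fintype X] (F : X → X → ℝ) :
    (Finset.expect univ fun ω : Fin 2 → X => F (ω 0) (ω 1)) =
      Finset.expect univ fun x => Finset.expect univ fun y => F x y := by
  rw [← expect_product' univ univ F, univ_product_univ]
  exact Fintype.expect_equiv (finTwoArrowEquiv X) _ _ fun ω => rfl

/-- The expected value of a deviation that may depend on the agent's own seed. -/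
theorem expect_gameValue_deviation (hG : G.WellFormed) (S : G.Search) (i : Fin 2)
    (π : Seed S → G.Policy i) :
    (Finset.expect univ fun ω : Fin 2 → Seed S =>
      G.gameValue (Function.update (fun j => testPolicy S j (ω j)) i (π (ω i))) i) =
      Finset.expect univ fun ω₀ : Seed S =>
        deviationValue S i (π ω₀) G.horizon initialPBS [] := by
  have h0 : ∀ ω : Fin 2 → Seed S, G.gameValue
      (Function.update (fun j => testPolicy S j (ω j)) i (π (ω i))) i =
      seededValue S i (π (ω i)) (ω (1 - i)) G.horizon initialPBS [] := fun ω =>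
    gameValue_testPolicy_eq hG S i _ ω fun j hj => by
      congr 1
      fin_cases i <;> fin_cases j <;> simp_all
  have h1 : ∀ ω₀ : Seed S, (Finset.expect univ fun ω : Seed S =>
      seededValue S i (π ω₀) ω G.horizon initialPBS []) =
      deviationValue S i (π ω₀) G.horizon initialPBS [] := fun ω₀ =>
    expect_seededValue hG S i _ _ (m := 0) (by simp [hist]) rfl
  simp only [h0, ← h1]
  fin_cases i
  · exact expect_pair fun x y => seededValue S 0 (π x) y G.horizon initialPBS []
  · rw [expect_comm]
    exact expect_pair fun x y => seededValue S 1 (π y) x G.horizon initialPBS []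

end TestPlay

/-! ### The leaf values are nearly zero-sum -/

section ZeroSum

variable {G : FOG W A Opriv Opub}

/-- The probability weight of a history of the subgame rooted at `β`. -/
def fullReach (G : FOG W A Opriv Opub) (β : PBS A Opriv Opub) (σ : ∀ i, G.Policy i)
    (h : List ((∀ i, A i) × W)) : ℝ :=
  G.chance h * ∏ j, reach β σ j (G.info j h)

/-- The probability weight of a root history. -/
def jointWeight (G : FOG W A Opriv Opub) (β : PBS A Opriv Opub)
    (h : List ((∀ i, A i) × W)) : ℝ :=
  G.chance h * ∏ j, β.range j (G.info j h)

theorem fullReach_cons (β : PBS A Opriv Opub) (σ : ∀ i, G.Policy i)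
    (a : ∀ i, A i) (w : W) {h : List ((∀ i, A i) × W)} (hh : β.pub.length ≤ h.length) :
    G.fullReach β σ ((a, w) :: h) = G.fullReach β σ h *
      ((∏ j, (σ j).prob (G.info j h) (a j)) * G.trans (G.world h) a w) := by
  have : ∀ j, reach β σ j (G.info j ((a, w) :: h)) =
      reach β σ j (G.info j h) * (σ j).prob (G.info j h) (a j) :=
    fun j => reach_cons β σ j _ (by simpa using hh)
  simp only [fullReach, this, prod_mul_distrib, chance]
  ring

theorem fullReach_eq_jointWeight (β : PBS A Opriv Opub) (σ : ∀ i, G.Policy i)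
    {h : List ((∀ i, A i) × W)} (hh : h.length ≤ β.pub.length) :
    G.fullReach β σ h = G.jointWeight β h := by
  rw [fullReach, jointWeight, prod_congr rfl fun j _ => reach_of_length_le β σ j (by simpa using hh)]

theorem fullReach_eq_mul_cfReach (β : PBS A Opriv Opub) (σ : ∀ i, G.Policy i) (i : Fin 2)
    (h : List ((∀ i, A i) × W)) :
    G.fullReach β σ h = reach β σ i (G.info i h) * G.cfReach β σ i h := by
  rw [fullReach, cfReach, ← mul_prod_erase univ _ (mem_univ i)]
  ring

theorem jointWeight_eq_mul_histWeight (β : PBS A Opriv Opub) (i : Fin 2)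
    (h : List ((∀ i, A i) × W)) :
    G.jointWeight β h = β.range i (G.info i h) * G.histWeight β i h := by
  rw [jointWeight, histWeight, ← mul_prod_erase univ _ (mem_univ i)]
  ring

theorem PBS.Valid.fullReach_nonneg {β : PBS A Opriv Opub} (hβ : β.Valid) (σ : ∀ i, G.Policy i)
    (h : List ((∀ i, A i) × W)) : 0 ≤ G.fullReach β σ h :=
  mul_nonneg (chance_nonneg h) (prod_nonneg fun j _ => (hβ.reach_mem σ j _).1)

theorem PBS.Valid.fullReach_le_one {β : PBS A Opriv Opub} (hβ : β.Valid) (σ : ∀ i, G.Policy i)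
    (h : List ((∀ i, A i) × W)) : G.fullReach β σ h ≤ 1 :=
  mul_le_one₀ (chance_le_one h) (prod_nonneg fun j _ => (hβ.reach_mem σ j _).1)
    (prod_le_one (fun j _ => (hβ.reach_mem σ j _).1) fun j _ => (hβ.reach_mem σ j _).2)

theorem PBS.Valid.fullReach_eq {β : PBS A Opriv Opub} (hβ : β.Valid) (S : G.Search)
    (σ : ∀ i, G.Policy i) {n : ℕ} {h : List ((∀ i, A i) × W)} (hh : h ∈ G.hist n) :
    G.fullReach β σ h =
      (∏ j, pubReach β σ j (G.pub h)) * G.jointWeight (leafPBS S β σ (G.pub h)) h := by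
  rw [fullReach, prod_congr rfl fun j _ => hβ.reach_eq S σ j (info_mem_infostates hh j),
    prod_mul_distrib, jointWeight]
  ring

theorem PBS.Valid.cfReach_pos_of_fullReach_pos {β : PBS A Opriv Opub} (hβ : β.Valid)
    {σ : ∀ i, G.Policy i} {h : List ((∀ i, A i) × W)} (hf : 0 < G.fullReach β σ h) (i : Fin 2) :
    0 < G.cfReach β σ i h := by
  rw [fullReach_eq_mul_cfReach β σ i] at hf
  exact pos_of_mul_pos_right hf (hβ.reach_mem σ i _).1

/-- The histories with `m` joint actions in the subgame rooted at a public state. -/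
def level (G : FOG W A Opriv Opub) (p : List Opub) (m : ℕ) : Finset (List ((∀ i, A i) × W)) :=
  (G.hist m).filter fun h => p <:+ G.pub h

theorem mem_level_length (p : List Opub) {h : List ((∀ i, A i) × W)} :
    h ∈ G.level p p.length ↔ h ∈ G.hist p.length ∧ G.pub h = p := by
  rw [level, mem_filter]
  refine and_congr_right fun hh => ⟨fun h1 => ?_, fun h1 => h1 ▸ List.suffix_rfl⟩
  exact (h1.eq_of_length (by simp [length_of_mem_hist hh])).symm

theorem sum_level_succ (p : List Opub) {m : ℕ} (hm : p.length ≤ m)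
    (F : List ((∀ i, A i) × W) → ℝ)
    (hF : ∀ h ∈ G.hist m, ∀ a w, (a, w) :: h ∉ G.hist (m + 1) → F ((a, w) :: h) = 0) :
    ∑ h ∈ G.level p m, ∑ a, ∑ w, F ((a, w) :: h) = ∑ h ∈ G.level p (m + 1), F h := by
  simp_rw [← sum_product']
  rw [← sum_filter_of_ne
    (p := fun x : List ((∀ i, A i) × W) × (∀ i, A i) × W => x.2 :: x.1 ∈ G.hist (m + 1))]
  · refine sum_nbij (fun x => x.2 :: x.1) ?_ ?_ ?_ ?_
    · rintro ⟨h, a, w⟩ hx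
      simp only [mem_filter, mem_product, mem_univ, and_true, level] at hx
      exact mem_filter.2 ⟨hx.2, suffix_pub_cons hx.1.2 _⟩
    · rintro ⟨h, a, w⟩ - ⟨h', a', w'⟩ - heq
      simp_all
    · intro h hh
      obtain ⟨h1, h2⟩ := mem_filter.1 hh
      obtain ⟨a, w, h', rfl⟩ := exists_of_mem_hist_succ h1
      have h3 := (cons_mem_hist.1 h1).1
      refine ⟨(h', a, w), ?_, rfl⟩
      simp only [coe_filter, mem_product, mem_univ, and_true, level, mem_filter,
        Set.mem_ofPred_eq]
      refine ⟨⟨h3, ?_⟩, h1⟩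
      -- The public state of the longer history is too long to equal `p`, so `p` is already a suffix
      -- at the parent.
      rcases List.suffix_cons_iff.1 h2 with h4 | h4
      · have := congrArg List.length h4
        simp only [List.length_cons, pub_length, length_of_mem_hist h3] at this
        omega
      · exact h4
    · intro x _; rfl
  · rintro ⟨h, a, w⟩ hx hne
    simp only [mem_product, mem_univ, and_true, level, mem_filter] at hx
    by_contra hn
    exact hne (hF h hx.1 a w hn)

/-- Rewards cancel between the agents, so the reach-weighted total is carried unchanged to the
leaves. -/
theorem sum_fullReach_mul_value (hG : G.WellFormed) (β : PBS A Opriv Opub) (σ : ∀ i, G.Policy i)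
    (L : Fin 2 → List ((∀ i, A i) × W) → ℝ) (n : ℕ) {m : ℕ} (hm : β.pub.length ≤ m) :
    ∑ h ∈ G.level β.pub m,
        G.fullReach β σ h * (G.value σ (L 0) 0 n h + G.value σ (L 1) 1 n h) =
      ∑ h ∈ G.level β.pub (m + n),
        G.fullReach β σ h * (G.value σ (L 0) 0 0 h + G.value σ (L 1) 1 0 h) := by
  induction n generalizing m with
  | zero => rfl
  | succ n ih =>
    rw [show m + (n + 1) = m + 1 + n by ring, ← ih (by omega), ← sum_level_succ _ hm]
    · refine sum_congr rfl fun h hh => ?_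
      have hh' := (mem_filter.1 hh).1
      have hl : β.pub.length ≤ h.length := by rwa [length_of_mem_hist hh']
      by_cases hT : G.Terminal h
      · rw [value_terminal _ _ _ _ hT, value_terminal _ _ _ _ hT, add_zero, mul_zero]
        refine (sum_eq_zero fun a _ => sum_eq_zero fun w _ => ?_).symm
        rw [fullReach_cons _ _ _ _ hl, jointProb_mul_trans_eq_zero hG σ hh', mul_zero, zero_mul]
        intro hm
        simpa [hT 0] using (cons_mem_hist.1 hm).2.1 0
      · rw [value_add_value_succ σ L n hT, mul_sum]
        refine sum_congr rfl fun a _ => ?_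
        rw [mul_sum]
        refine sum_congr rfl fun w _ => ?_
        rw [fullReach_cons _ _ _ _ hl]
        ring
    · intro h hh a w hm'
      rw [fullReach_cons _ _ _ _ (by rwa [length_of_mem_hist hh]),
        jointProb_mul_trans_eq_zero hG σ hh hm', mul_zero, zero_mul]

theorem PBS.Valid.rootWeight_mul_rootValue {S : G.Search} {β : PBS A Opriv Opub} (hβ : β.Valid)
    (σ : ∀ i, G.Policy i) (i : Fin 2) (s : List (A i × Opriv i × Opub)) :
    G.rootWeight β i s * rootValue S β σ i s =
      ∑ h ∈ G.histOf i s, G.histWeight β i h *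
        G.value σ (leafValue S β σ i) i (S.depth β.pub) h := by
  by_cases h0 : G.rootWeight β i s = 0
  · rw [h0, zero_mul]
    exact (sum_eq_zero fun h hh => by rw [hβ.histWeight_eq_zero h0 hh, zero_mul]).symm
  · exact mul_div_cancel₀ _ h0

/-- Weighting each infostate by agent `i`'s own belief turns the conditional expectations back into
one over the joint belief. The two agents' values, grouped by different infostates, can then be
added history by history. -/
theorem PBS.Valid.sum_jointWeight_mul_rootValue {S : G.Search} {β : PBS A Opriv Opub}
    (hβ : β.Valid) (σ : ∀ i, G.Policy i) (i : Fin 2) :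
    ∑ h ∈ G.level β.pub β.pub.length, G.jointWeight β h * rootValue S β σ i (G.info i h) =
      ∑ h ∈ G.level β.pub β.pub.length, G.jointWeight β h *
        G.value σ (leafValue S β σ i) i (S.depth β.pub) h := by
  have hmaps : ∀ h ∈ G.level β.pub β.pub.length, G.info i h ∈ G.infostates i β.pub := by
    intro h hh
    obtain ⟨h1, h2⟩ := (mem_level_length _).1 hh
    exact mem_infostates.2 ⟨h, h1, h2, rfl⟩
  rw [← sum_fiberwise_of_maps_to hmaps, ← sum_fiberwise_of_maps_to hmaps]
  refine sum_congr rfl fun s hs => ?_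
  have hset : (G.level β.pub β.pub.length).filter (fun h => G.info i h = s) = G.histOf i s := by
    ext h
    rw [mem_filter, mem_level_length, mem_histOf, length_of_mem_infostates hs]
    refine ⟨fun h1 => ⟨h1.1.1, h1.2⟩, fun h1 => ⟨⟨h1.1, ?_⟩, h1.2⟩⟩
    rw [← pubOfInfo_info i, h1.2, pubOfInfo_of_mem_infostates hs]
  rw [hset]
  have h1 : ∀ h ∈ G.histOf i s, G.jointWeight β h = β.range i s * G.histWeight β i h := by
    intro h hh
    rw [jointWeight_eq_mul_histWeight β i, (mem_histOf.1 hh).2]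
  calc _ = ∑ h ∈ G.histOf i s, β.range i s * (G.histWeight β i h * rootValue S β σ i s) :=
        sum_congr rfl fun h hh => by rw [h1 h hh, (mem_histOf.1 hh).2, mul_assoc]
    _ = ∑ h ∈ G.histOf i s, β.range i s * (G.histWeight β i h *
          G.value σ (leafValue S β σ i) i (S.depth β.pub) h) := by
        rw [← mul_sum, ← mul_sum, ← hβ.rootWeight_mul_rootValue, rootWeight_eq, sum_mul]
    _ = _ := sum_congr rfl fun h hh => by rw [h1 h hh, mul_assoc]

theorem trainingValue_terminal {S : G.Search} {β : PBS A Opriv Opub} {i : Fin 2}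
    {s : List (A i × Opriv i × Opub)} (hT : ∀ h ∈ G.histOf i s, G.Terminal h) :
    trainingValue S β i s S.T = 0 := by
  rw [trainingValue_eq, sum_eq_zero, zero_div]
  intro t _
  rw [rootValue, sum_eq_zero, zero_div]
  intro h hh
  rw [value_terminal _ _ _ _ (hT h hh), mul_zero]

/-- The sum of the two agents' values of the subgame, weighted by the belief. -/
def totalValue {G : FOG W A Opriv Opub} (S : G.Search) (β : PBS A Opriv Opub)
    (σ : ∀ i, G.Policy i) : ℝ :=
  ∑ h ∈ G.level β.pub β.pub.length, G.jointWeight β h *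
    (G.value σ (leafValue S β σ 0) 0 (S.depth β.pub) h +
      G.value σ (leafValue S β σ 1) 1 (S.depth β.pub) h)

theorem PBS.Valid.sum_jointWeight_mul_trainingValue {S : G.Search} {β : PBS A Opriv Opub}
    (hβ : β.Valid) :
    ∑ h ∈ G.level β.pub β.pub.length, G.jointWeight β h *
        (trainingValue S β 0 (G.info 0 h) S.T + trainingValue S β 1 (G.info 1 h) S.T) =
      (∑ t ∈ Finset.range (S.T + 1), totalValue S β (iterate S β t)) / (S.T + 1) := by
  have h1 : ∀ t, totalValue S β (iterate S β t) =
      ∑ h ∈ G.level β.pub β.pub.length, (G.jointWeight β h *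
        rootValue S β (iterate S β t) 0 (G.info 0 h) +
        G.jointWeight β h * rootValue S β (iterate S β t) 1 (G.info 1 h)) := by
    intro t
    rw [sum_add_distrib, hβ.sum_jointWeight_mul_rootValue, hβ.sum_jointWeight_mul_rootValue,
      ← sum_add_distrib]
    exact sum_congr rfl fun h _ => mul_add _ _ _
  simp only [h1, trainingValue_eq]
  rw [sum_comm, sum_div]
  refine sum_congr rfl fun h _ => ?_
  rw [sum_add_distrib, ← mul_sum, ← mul_sum]
  ring

theorem PBS.Valid.sum_fullReach_le (hG : G.WellFormed) {β : PBS A Opriv Opub} (hβ : β.Valid)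
    (σ : ∀ i, G.Policy i) {X : Finset (List ((∀ i, A i) × W))} {m : ℕ} (hX : X ⊆ G.hist m) :
    ∑ h ∈ X, G.fullReach β σ h ≤ G.numHist := by
  refine (sum_le_card_nsmul _ _ 1 fun h _ => hβ.fullReach_le_one σ h).trans ?_
  rw [nsmul_eq_mul, mul_one]
  exact (Nat.cast_le.2 (card_le_card hX)).trans (hG.card_hist_le m)

theorem Reachable.value_leaf_add_le (hG : G.WellFormed) {S : G.Search} {δ : ℝ} (hδ : 0 ≤ δ)
    (hS : TrainedWithError S δ) {β : PBS A Opriv Opub} (hβ : Reachable S β) {t : ℕ}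
    (ht : t ≤ S.T) {h : List ((∀ i, A i) × W)}
    (hh : h ∈ G.level β.pub (β.pub.length + S.depth β.pub))
    (hf : 0 < G.fullReach β (iterate S β t) h) (i : Fin 2) :
    G.value (iterate S β t) (leafValue S β (iterate S β t) i) i 0 h ≤
      trainingValue S (leafPBS S β (iterate S β t) (G.pub h)) i (G.info i h) S.T + δ := by
  obtain ⟨h1, h2⟩ := mem_filter.1 hh
  by_cases hT : G.Terminal h
  · rw [value_terminal _ _ _ _ hT, trainingValue_terminal, zero_add]
    · exact hδ
    · exact fun h' hh' => hG.terminal_congr (mem_histOf_info h1) hh' hT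
  · rw [value_zero _ _ _ hT]
    have := (abs_le.1 (hβ.abs_leafValue_sub_le hG hS ht h1 rfl h2 hT
      (hβ.valid.cfReach_pos_of_fullReach_pos hf i))).2
    linarith

/-- The leaf values are zero-sum up to the training error. -/
theorem exists_totalValue_le (hG : G.WellFormed) (k : ℕ) : ∃ c : ℝ, 0 ≤ c ∧
    ∀ (S : G.Search) (δ : ℝ), 0 ≤ δ → TrainedWithError S δ → ∀ β, Reachable S β →
      G.horizon ≤ β.pub.length + k → ∀ t ≤ S.T, totalValue S β (iterate S β t) ≤ c * δ := by
  have hN := hG.one_le_numHist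
  induction k with
  | zero =>
    refine ⟨0, le_rfl, fun S δ _ _ β _ hk t _ => ?_⟩
    rw [totalValue, sum_eq_zero, zero_mul]
    intro h hh
    have h1 := ((mem_level_length _).1 hh).1
    have hT : G.Terminal h := by
      by_contra hT
      have := hG.lt_horizon h1 hT
      omega
    rw [value_terminal _ _ _ _ hT, value_terminal _ _ _ _ hT, add_zero, mul_zero]
  | succ k ih =>
    obtain ⟨c, hc, ih⟩ := ih
    -- There are at most `numHist` leaf public states. At each, the two public reaches contribute at
    -- most `numHist ^ 2` to the inductive bound, and replacing both network values costs `2 * δ` on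
    -- total reach at most `numHist`.
    refine ⟨G.numHist * (G.numHist ^ 2 * c + 2 * G.numHist), by positivity,
      fun S δ hδ hS β hβ hk t ht => ?_⟩
    set σ := iterate S β t with hσ
    set l := G.level β.pub (β.pub.length + S.depth β.pub) with hl
    have hd := S.depth_pos β.pub
    have e1 : totalValue S β σ = ∑ h ∈ l, G.fullReach β σ h *
        (G.value σ (leafValue S β σ 0) 0 0 h + G.value σ (leafValue S β σ 1) 1 0 h) := by
      rw [← sum_fullReach_mul_value hG β σ (leafValue S β σ) _ le_rfl]
      refine sum_congr rfl fun h hh => ?_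
      rw [fullReach_eq_jointWeight _ _ (length_of_mem_hist ((mem_level_length _).1 hh).1).le]
    rw [e1, ← sum_fiberwise_of_maps_to (t := l.image G.pub) (g := G.pub)
      fun h hh => mem_image_of_mem _ hh]
    have hcard : ((l.image G.pub).card : ℝ) ≤ G.numHist :=
      (Nat.cast_le.2 (card_image_le.trans (card_filter_le _ _))).trans (hG.card_hist_le _)
    refine (sum_le_card_nsmul _ _ ((G.numHist ^ 2 * c + 2 * G.numHist) * δ) fun p hp => ?_).trans ?_
    -- One nonterminal history of positive reach puts the leaf PBS into the run; without one, the
    -- whole public state contributes zero.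
    · by_cases hex : ∃ h ∈ l, G.pub h = p ∧ ¬ G.Terminal h ∧ 0 < G.fullReach β σ h
      · obtain ⟨h₀, hh₀, rfl, hT₀, hf₀⟩ := hex
        obtain ⟨h1, h2⟩ := mem_filter.1 hh₀
        set β' := leafPBS S β σ (G.pub h₀) with hβ'
        have hr : Reachable S β' := hβ.leaf ht h1 rfl h2 hT₀
          (hβ.valid.cfReach_pos_of_fullReach_pos hf₀ 0)
        have hlen : β'.pub.length = β.pub.length + S.depth β.pub := by
          simp [hβ', leafPBS, length_of_mem_hist h1]
        have hset : l.filter (fun h => G.pub h = G.pub h₀) = G.level β'.pub β'.pub.length := by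
          ext h
          rw [mem_filter, mem_level_length, hlen, hl, level, mem_filter]
          refine ⟨fun h3 => ⟨h3.1.1, h3.2⟩, fun h3 => ⟨⟨h3.1, ?_⟩, h3.2⟩⟩
          rw [h3.2]; exact h2
        have hsub : l.filter (fun h => G.pub h = G.pub h₀) ⊆
            G.hist (β.pub.length + S.depth β.pub) :=
          (filter_subset _ _).trans (filter_subset _ _)
        have htot : (∑ t ∈ range (S.T + 1), totalValue S β' (iterate S β' t)) / (S.T + 1) ≤
            c * δ := by
          rw [div_le_iff₀ (by positivity)]
          refine (sum_le_card_nsmul _ _ (c * δ) fun t' ht' => ?_).trans (le_of_eq ?_)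
          · exact ih S δ hδ hS β' hr (by omega) t' (by simpa [Nat.lt_succ_iff] using ht')
          · simp [mul_comm]
        calc _ ≤ ∑ h ∈ l.filter (fun h => G.pub h = G.pub h₀),
              ((∏ j, pubReach β σ j (G.pub h₀)) * (G.jointWeight β' h *
                (trainingValue S β' 0 (G.info 0 h) S.T + trainingValue S β' 1 (G.info 1 h) S.T)) +
              G.fullReach β σ h * (2 * δ)) := by
              refine sum_le_sum fun h hh => ?_
              obtain ⟨h3, h4⟩ := mem_filter.1 hh
              have h5 := hβ.valid.fullReach_eq S σ (mem_filter.1 h3).1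
              rw [h4] at h5
              rw [← mul_assoc, ← h5, ← mul_add]
              rcases (hβ.valid.fullReach_nonneg σ h).eq_or_lt with h6 | h6
              · rw [← h6, zero_mul, zero_mul]
              · refine mul_le_mul_of_nonneg_left ?_ h6.le
                have h7 := hβ.value_leaf_add_le hG hδ hS ht h3 h6
                simp only [h4] at h7
                linarith [h7 0, h7 1]
          _ ≤ G.numHist ^ 2 * (c * δ) + G.numHist * (2 * δ) := by
              rw [sum_add_distrib, ← mul_sum, ← sum_mul]
              have hK : ∏ j, pubReach β σ j (G.pub h₀) ≤ G.numHist ^ 2 := by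
                refine (prod_le_prod (fun j _ => hβ.valid.pubReach_nonneg σ j _)
                  fun j _ => hβ.valid.pubReach_le hG σ j _).trans ?_
                simp
              have hK0 : 0 ≤ ∏ j, pubReach β σ j (G.pub h₀) :=
                prod_nonneg fun j _ => hβ.valid.pubReach_nonneg σ j _
              refine add_le_add ?_ (mul_le_mul_of_nonneg_right
                (hβ.valid.sum_fullReach_le hG σ hsub) (by positivity))
              rw [hset, hr.valid.sum_jointWeight_mul_trainingValue]
              exact (mul_le_mul_of_nonneg_left htot hK0).trans
                (mul_le_mul_of_nonneg_right hK (by positivity))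
          _ = _ := by ring
      · push Not at hex
        rw [sum_eq_zero]
        · positivity
        · intro h hh
          obtain ⟨h3, h4⟩ := mem_filter.1 hh
          by_cases hT : G.Terminal h
          · rw [value_terminal _ _ _ _ hT, value_terminal _ _ _ _ hT, add_zero, mul_zero]
          · rw [le_antisymm (hex h h3 h4 hT) (hβ.valid.fullReach_nonneg σ h), zero_mul]
    · rw [nsmul_eq_mul, mul_assoc]
      exact mul_le_mul_of_nonneg_right hcard (by positivity)

end ZeroSum

/-! ### No deviation gains much over the played value -/

section Main

variable {G : FOG W A Opriv Opub}

theorem one_le_sqrt_T (S : G.Search) : 1 ≤ √(S.T : ℝ) :=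
  Real.one_le_sqrt.2 (by exact_mod_cast S.T_pos)

/-- Bounds on values grow like `1 + δ`, and regret matching divides them by `√T`. Since `√T ≥ 1`,
the mixed term `δ / √T` is absorbed into `δ`. -/
theorem valueBound_le (S : G.Search) {δ : ℝ} (hδ : 0 ≤ δ) :
    G.valueBound δ ≤ √S.T * ((G.horizon + 1) * (G.rewardBound + 1) * (δ + 1 / √S.T)) := by
  have h1 := one_le_sqrt_T S
  have hR := rewardBound_nonneg (G := G)
  have h2 : √(S.T : ℝ) * (δ + 1 / √S.T) = √S.T * δ + 1 := by
    field_simp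
  have h3 : δ ≤ √S.T * δ := le_mul_of_one_le_left hδ h1
  calc G.valueBound δ = (G.horizon + 1) * (G.rewardBound + δ) := rfl
    _ ≤ (G.horizon + 1) * ((G.rewardBound + 1) * (√S.T * δ + 1)) := by
        refine mul_le_mul_of_nonneg_left ?_ (by positivity)
        nlinarith [mul_nonneg hR (hδ.trans h3)]
    _ = _ := by rw [← h2]; ring

theorem rewardBound_le (S : G.Search) {δ : ℝ} (hδ : 0 ≤ δ) :
    G.rewardBound ≤ √S.T * (G.rewardBound * (δ + 1 / √S.T)) := by
  have h1 := one_le_sqrt_T S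
  have hR := rewardBound_nonneg (G := G)
  have h2 : √(S.T : ℝ) * (G.rewardBound * (δ + 1 / √S.T)) =
      G.rewardBound * (√S.T * δ) + G.rewardBound := by
    field_simp
  rw [h2]
  have : 0 ≤ G.rewardBound * (√S.T * δ) := by positivity
  linarith

/-- Compares the iterates that are drawn in play with those averaged by the search, which also
include iterate `T`. Adding one term moves a mean by the distance to that term over `T + 1`. -/
theorem average_sub_average_le {r : ℕ → ℝ} {B : ℝ} {T : ℕ} (hT : 0 < T)
    (h : ∀ t ≤ T, |r t| ≤ B) :
    (∑ t ∈ range T, r t) / T - (∑ t ∈ range (T + 1), r t) / (T + 1) ≤ 2 * B / (T + 1) := by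
  have hT' : (0 : ℝ) < T := Nat.cast_pos.2 hT
  have h1 : (∑ t ∈ range T, r t) ≤ T * B := by
    refine (sum_le_card_nsmul _ _ B fun t ht => ?_).trans (by simp)
    exact (abs_le.1 (h t (mem_range.1 ht).le)).2
  have h2 := (abs_le.1 (h T le_rfl)).1
  have h3 : (∑ t ∈ range T, r t) / T ≤ B := by
    rw [div_le_iff₀ hT']; linarith
  have h4 : (∑ t ∈ range T, r t) / T - (∑ t ∈ range (T + 1), r t) / (T + 1) =
      ((∑ t ∈ range T, r t) / T - r T) / (T + 1) := by
    rw [sum_range_succ]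
    field_simp
    ring
  rw [h4]
  exact div_le_div_of_nonneg_right (by linarith) (by positivity)

/-- The average of the values at root infostate `s` over the iterations drawn in test-time play. -/
def playedValue {G : FOG W A Opriv Opub} (S : G.Search) (β : PBS A Opriv Opub) (i : Fin 2)
    (h : List ((∀ i, A i) × W)) : ℝ :=
  (∑ t ∈ range S.T, G.value (iterate S β t) (leafValue S β (iterate S β t) i) i
    (S.depth β.pub) h) / S.T

theorem deviationValue_succ (S : G.Search) (i : Fin 2) (π : G.Policy i) (n : ℕ)
    (β : PBS A Opriv Opub) (h : List ((∀ i, A i) × W)) :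
    deviationValue S i π (n + 1) β h = (∑ t ∈ range S.T,
      G.value (Function.update (iterate S β t) i π)
        (fun z => deviationValue S i π n (leafPBS S β (iterate S β t) (G.pub z)) z) i
        (S.depth β.pub) h) / S.T := by
  rw [deviationValue, Fintype.expect_eq_sum_div_card, Fintype.card_fin,
    ← Fin.sum_univ_eq_sum_range (fun t : ℕ => G.value (Function.update (iterate S β t) i π)
        (fun z => deviationValue S i π n (leafPBS S β (iterate S β t) (G.pub z)) z) i
        (S.depth β.pub) h)]

/-- At the root no action of the subgame has been played, so the counterfactual reach is the same on
every iteration. -/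
theorem sum_histWeight_mul_sub_eq (S : G.Search) {β : PBS A Opriv Opub} (i : Fin 2)
    (π : G.Policy i) (n : ℕ) {s : List (A i × Opriv i × Opub)} (hs : s.length = β.pub.length) :
    ∑ h ∈ G.histOf i s, G.histWeight β i h *
        (deviationValue S i π (n + 1) β h - playedValue S β i h) =
      (∑ t ∈ range S.T, cfGain S β (iterate S β t) i π
        (fun z => deviationValue S i π n (leafPBS S β (iterate S β t) (G.pub z)) z)
        (S.depth β.pub) s) / S.T := by
  simp only [cfGain]
  rw [sum_comm, sum_div]
  refine sum_congr rfl fun h hh => ?_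
  have hw : ∀ t, G.cfReach β (iterate S β t) i h = G.histWeight β i h := fun t =>
    cfReach_of_length_le _ _ _ (by rw [length_of_mem_hist (mem_histOf.1 hh).1, hs])
  simp only [hw]
  rw [← mul_sum, deviationValue_succ, playedValue, ← sub_div, ← sum_sub_distrib, mul_div_assoc]

/-- The average over the played iterations is close to the output of the search. -/
theorem Reachable.sum_histWeight_mul_playedValue_le (hG : G.WellFormed) {S : G.Search} {δ : ℝ}
    (hδ : 0 ≤ δ) (hS : TrainedWithError S δ) {β : PBS A Opriv Opub} (hβ : Reachable S β)
    {i : Fin 2} {s : List (A i × Opriv i × Opub)} (hs : s ∈ G.infostates i β.pub) :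
    ∑ h ∈ G.histOf i s, G.histWeight β i h * playedValue S β i h ≤
      G.rootWeight β i s * (trainingValue S β i s S.T + 2 * G.valueBound δ / (S.T + 1)) := by
  have h1 : ∑ h ∈ G.histOf i s, G.histWeight β i h * playedValue S β i h =
      G.rootWeight β i s * ((∑ t ∈ range S.T, rootValue S β (iterate S β t) i s) / S.T) := by
    rw [← mul_div_assoc, mul_sum]
    simp only [hβ.valid.rootWeight_mul_rootValue, playedValue, ← mul_div_assoc, mul_sum]
    rw [← sum_div, sum_comm]
  rw [h1, trainingValue_eq]
  refine mul_le_mul_of_nonneg_left ?_ (hβ.valid.rootWeight_nonneg i s)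
  rw [← sub_le_iff_le_add']
  refine average_sub_average_le S.T_pos fun t ht => ?_
  refine hβ.valid.abs_rootValue_le (valueBound_nonneg hδ) fun h hh hw => ?_
  have hl := length_of_mem_infostates hs
  obtain ⟨h2, h3⟩ := mem_histOf.1 hh
  refine hβ.abs_value_le hG hδ hS ht i _ h2 ?_ (by omega) ?_
  · rw [pub_of_mem_histOf hh, pubOfInfo_of_mem_infostates hs]
  · rw [cfReach_of_length_le _ _ _ (by rw [length_of_mem_hist h2, hl])]
    exact hw

/-- At the leaves, the deviator gains little over the value given by the network. -/
theorem Reachable.sum_leaf_gain_le (hG : G.WellFormed) {S : G.Search} {δ : ℝ}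
    (hδ : 0 ≤ δ) (hS : TrainedWithError S δ) {β : PBS A Opriv Opub} (hβ : Reachable S β) {t : ℕ}
    (ht : t ≤ S.T) {i : Fin 2} {s : List (A i × Opriv i × Opub)} (hp : β.pub <:+ pubOfInfo s)
    (hs : s.length = β.pub.length + S.depth β.pub) (hT : ∀ h ∈ G.histOf i s, ¬ G.Terminal h)
    (V : PBS A Opriv Opub → List ((∀ i, A i) × W) → ℝ) {ε : ℝ} (hε : 0 ≤ ε)
    (hV : ∀ β', Reachable S β' → s ∈ G.infostates i β'.pub →
      ∑ h ∈ G.histOf i s, G.histWeight β' i h * (V β' h - playedValue S β' i h) ≤ ε) :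
    ∑ h ∈ G.histOf i s, G.cfReach β (iterate S β t) i h *
        (V (leafPBS S β (iterate S β t) (G.pub h)) h - leafValue S β (iterate S β t) i h) ≤
      G.numHist * (ε + G.numHist * (2 * G.valueBound δ / (S.T + 1) + δ)) := by
  have hN := hG.one_le_numHist
  have hB := valueBound_nonneg (G := G) hδ
  by_cases hex : ∃ h ∈ G.histOf i s, 0 < G.cfReach β (iterate S β t) i h
  swap
  · push Not at hex
    rw [sum_eq_zero]
    · positivity
    · intro h hh
      rw [le_antisymm (hex h hh) (hβ.valid.cfReach_nonneg _ i h), zero_mul]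
  obtain ⟨h₀, hh₀, hc₀⟩ := hex
  obtain ⟨h1, h2⟩ := mem_histOf.1 hh₀
  have hpub := pub_of_mem_histOf hh₀
  have hp₀ : β.pub <:+ G.pub h₀ := by rwa [hpub]
  set β' := leafPBS S β (iterate S β t) (pubOfInfo s) with hβ'
  have hr : Reachable S β' := by
    rw [hβ', ← hpub]
    exact hβ.leaf ht h1 hs hp₀ (hT h₀ hh₀) hc₀
  have hs' : s ∈ G.infostates i β'.pub := by
    have := info_mem_infostates h1 i
    rwa [h2, hpub] at this
  have hW := hr.valid.rootWeight_nonneg (G := G) i s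
  have hW1 := hr.valid.rootWeight_le hG i s
  have hv : trainingValue S β' i s S.T - δ ≤ S.vhat β' i s := by
    have := (abs_le.1 (hβ.abs_leafValue_sub_le hG hS ht h1 hs hp₀ (hT h₀ hh₀) hc₀)).1
    rw [leafValue, h2, hpub] at this
    linarith
  set K := ∏ j ∈ univ.erase i, pubReach β (iterate S β t) j (pubOfInfo s) with hK
  have hK0 : 0 ≤ K := prod_nonneg fun j _ => hβ.valid.pubReach_nonneg _ j _
  have hK1 : K ≤ G.numHist := hβ.valid.prod_pubReach_le hG _ i _
  -- All histories of `s` share a public state, hence one leaf PBS, one network value and one factor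
  -- `K`. The gain is then split at the played value of the next subgame.
  have e1 : ∑ h ∈ G.histOf i s, G.cfReach β (iterate S β t) i h *
      (V (leafPBS S β (iterate S β t) (G.pub h)) h - leafValue S β (iterate S β t) i h) =
      K * (∑ h ∈ G.histOf i s, G.histWeight β' i h * (V β' h - playedValue S β' i h) +
        (∑ h ∈ G.histOf i s, G.histWeight β' i h * playedValue S β' i h -
          G.rootWeight β' i s * S.vhat β' i s)) := by
    rw [rootWeight_eq, sum_mul, ← sum_sub_distrib, ← sum_add_distrib, mul_sum]
    refine sum_congr rfl fun h hh => ?_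
    obtain ⟨h3, h4⟩ := mem_histOf.1 hh
    rw [hβ.valid.cfReach_eq S _ i h3, leafValue, h4, pub_of_mem_histOf hh]
    change K * G.histWeight β' i h * _ = _
    ring
  have h5 := hr.sum_histWeight_mul_playedValue_le hG hδ hS hs'
  have h6 := mul_le_mul_of_nonneg_left hv hW
  have h7 : 0 ≤ 2 * G.valueBound δ / ((S.T : ℝ) + 1) + δ := by positivity
  have h8 := mul_le_mul_of_nonneg_right hW1 h7
  rw [e1]
  calc _ ≤ K * (ε + G.numHist * (2 * G.valueBound δ / (S.T + 1) + δ)) :=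
        mul_le_mul_of_nonneg_left (add_le_add (hV β' hr hs') (by linarith)) hK0
    _ ≤ _ := mul_le_mul_of_nonneg_right hK1 (by positivity)

/-- No deviation in test-time play from a PBS of the run gains much over the played value. -/
theorem exists_deviationValue_le (hG : G.WellFormed) (n : ℕ) : ∃ e : ℝ, 0 ≤ e ∧
    ∀ (S : G.Search) (δ : ℝ), 0 ≤ δ → TrainedWithError S δ → ∀ (i : Fin 2) (π : G.Policy i) (β),
      Reachable S β → G.horizon ≤ β.pub.length + n → ∀ s ∈ G.infostates i β.pub,
      ∑ h ∈ G.histOf i s, G.histWeight β i h *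
        (deviationValue S i π n β h - playedValue S β i h) ≤ e * (δ + 1 / √S.T) := by
  have hN := hG.one_le_numHist
  have hR := rewardBound_nonneg (G := G)
  induction n with
  | zero =>
    refine ⟨0, le_rfl, fun S δ _ _ i π β _ hk s hs => ?_⟩
    rw [sum_eq_zero, zero_mul]
    intro h hh
    have h1 := (mem_histOf.1 hh).1
    have h2 := length_of_mem_infostates hs
    have hT : G.Terminal h := by
      by_contra hT
      have := hG.lt_horizon h1 hT
      omega
    simp [deviationValue, playedValue, value_terminal _ _ _ _ hT]
  | succ n ih =>
    obtain ⟨e, he, ih⟩ := ih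
    -- Up to powers of `√T` and the factor `η`, `b` bounds values, `d` instantaneous regrets and `a`
    -- the number of actions. In `x`, the first summand covers the regrets and the second the leaf
    -- gains.
    set b : ℝ := (G.horizon + 1) * (G.rewardBound + 1) with hb
    set J : ℝ := ((Fintype.card (∀ i, A i) : ℕ) : ℝ) with hJ
    set d : ℝ := G.numHist * (J * (G.rewardBound + b) + b) with hd
    set a : ℝ := ∑ i, (Fintype.card (A i) : ℝ) with ha
    set x : ℝ := a * d + G.numHist * (e + G.numHist * (2 * b + 1)) with hx
    have hb0 : 0 ≤ b := by positivity
    have hd0 : 0 ≤ d := by positivity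
    have ha0 : 0 ≤ a := by positivity
    have hx0 : 0 ≤ x := by positivity
    refine ⟨(1 + G.numHist) ^ G.horizon * x, by positivity,
      fun S δ hδ hS i π β hβ hk s hs => ?_⟩
    have hT1 := one_le_sqrt_T S
    have hTT : √(S.T : ℝ) * √S.T = S.T := Real.mul_self_sqrt (Nat.cast_nonneg _)
    have hT0 : (0 : ℝ) < S.T := Nat.cast_pos.2 S.T_pos
    set η := δ + 1 / √S.T with hη
    have hη0 : 0 ≤ η := by positivity
    have hδη : δ ≤ η := le_add_of_nonneg_right (by positivity)
    have hl := length_of_mem_infostates hs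
    have hB : G.valueBound δ ≤ √S.T * (b * η) := valueBound_le S hδ
    have hR1 : G.rewardBound ≤ √S.T * (G.rewardBound * η) := rewardBound_le S hδ
    have hB0 := valueBound_nonneg (G := G) hδ
    -- The bound `X` is linear in `T`: the regrets carry one `√T` from Blackwell's bound and one
    -- from `valueBound_le`, while the leaf gains add up over `T` iterations. Dividing by `T` leaves
    -- `x * η`.
    rw [sum_histWeight_mul_sub_eq S i π n hl, div_le_iff₀ hT0]
    refine (sum_cfGain_le hG S π _ (X := S.T * (x * η)) (by positivity) ?_ ?_ _ G.horizon
      (by rw [pubOfInfo_of_mem_infostates hs]) (by omega) (by omega)).trans (le_of_eq (by ring))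
    · intro s' hp' hs' c hc
      set D := G.numHist * (J * (G.rewardBound + G.valueBound δ) + G.valueBound δ) with hD
      have hD0 : 0 ≤ D := by positivity
      have hD1 : D ≤ √S.T * (d * η) := by
        calc D ≤ G.numHist * (J * (√S.T * (G.rewardBound * η) + √S.T * (b * η)) +
              √S.T * (b * η)) := by
              rw [hD]
              gcongr
          _ = _ := by rw [hd]; ring
      have hcard : (Fintype.card (A i) : ℝ) ≤ a :=
        single_le_sum (f := fun i => (Fintype.card (A i) : ℝ)) (fun _ _ => by positivity)
          (mem_univ i)
      calc cumRegret S β S.T i s' c ≤ √S.T * (Fintype.card (A i) * D) :=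
            cumRegret_le hG S β hs' hD0 S.T
              (fun t ht b hb => hβ.abs_instRegret_le hG hδ hS ht.le hp' hs' hb) hc
        _ ≤ √S.T * (a * (√S.T * (d * η))) := by gcongr
        _ = √S.T * √S.T * (a * d * η) := by ring
        _ = S.T * (a * d * η) := by rw [hTT]
        _ ≤ S.T * (x * η) := by
            gcongr
            exact le_add_of_nonneg_right (by positivity)
    · intro s' hp' hs' hT'
      refine (sum_le_card_nsmul _ _ (x * η) fun t ht => ?_).trans (by simp)
      have := hβ.sum_leaf_gain_le hG hδ hS (mem_range.1 ht).le hp' hs' hT'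
        (deviationValue S i π n) (ε := e * η) (by positivity) fun β' hβ'  hs'' => by
          refine ih S δ hδ hS i π β' hβ' ?_ s' hs''
          have h1 := length_of_mem_infostates hs''
          have h2 := S.depth_pos β.pub
          omega
      refine this.trans ?_
      have hdiv : G.valueBound δ / (S.T + 1) ≤ b * η := by
        rw [div_le_iff₀ (by positivity)]
        refine hB.trans ?_
        rw [mul_comm]
        have : √(S.T : ℝ) ≤ S.T + 1 := by nlinarith
        gcongr
      calc _ ≤ G.numHist * (e * η + G.numHist * (2 * (b * η) + η)) := by
            rw [mul_div_assoc]
            gcongr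
        _ = (G.numHist * (e + G.numHist * (2 * b + 1))) * η := by ring
        _ ≤ x * η := by
            gcongr
            exact le_add_of_nonneg_left (by positivity)

end Main

/-! ### From deviation bounds to the equilibrium -/

section Equilibrium

variable {G : FOG W A Opriv Opub}

theorem histOf_nil (i : Fin 2) : G.histOf i [] = {[]} := by
  ext h
  simp only [mem_histOf, List.length_nil, hist, mem_singleton]
  exact ⟨fun h1 => h1.1, fun h1 => ⟨h1, by rw [h1]; rfl⟩⟩

theorem exists_deviationValue_initial_le (hG : G.WellFormed) : ∃ e : ℝ, 0 ≤ e ∧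
    ∀ (S : G.Search) (δ : ℝ), 0 ≤ δ → TrainedWithError S δ → ∀ (i : Fin 2) (π : G.Policy i),
      deviationValue S i π G.horizon initialPBS [] ≤
        playedValue S initialPBS i [] + e * (δ + 1 / √S.T) := by
  obtain ⟨e, he, h⟩ := exists_deviationValue_le hG G.horizon
  refine ⟨e, he, fun S δ hδ hS i π => ?_⟩
  have h1 := h S δ hδ hS i π initialPBS Relation.ReflTransGen.refl (by omega) []
    (mem_infostates.2 ⟨[], by simp [initialPBS, hist], rfl, rfl⟩)
  rw [histOf_nil, sum_singleton] at h1
  have hw : G.histWeight (initialPBS : PBS A Opriv Opub) i [] = 1 := by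
    simp [histWeight, chance, initialPBS, info]
  rw [hw, one_mul] at h1
  linarith

theorem exists_playedValue_add_le (hG : G.WellFormed) : ∃ c : ℝ, 0 ≤ c ∧
    ∀ (S : G.Search) (δ : ℝ), 0 ≤ δ → TrainedWithError S δ →
      playedValue S initialPBS 0 [] + playedValue S initialPBS 1 [] ≤ c * δ := by
  obtain ⟨c, hc, h⟩ := exists_totalValue_le hG G.horizon
  refine ⟨c, hc, fun S δ hδ hS => ?_⟩
  have hT0 : (0 : ℝ) < S.T := Nat.cast_pos.2 S.T_pos
  have hl : G.level (initialPBS : PBS A Opriv Opub).pub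
      (initialPBS : PBS A Opriv Opub).pub.length = {[]} := by
    ext h
    simp [level, hist, initialPBS]
  have hw : G.jointWeight (initialPBS : PBS A Opriv Opub) [] = 1 := by
    simp [jointWeight, chance, initialPBS, info]
  rw [playedValue, playedValue, ← add_div, ← sum_add_distrib, div_le_iff₀ hT0]
  refine (sum_le_card_nsmul _ _ (c * δ) fun t ht => ?_).trans (le_of_eq (by simp [mul_comm]))
  have := h S δ hδ hS initialPBS Relation.ReflTransGen.refl (by omega) t (mem_range.1 ht).le
  rwa [totalValue, hl, sum_singleton, hw, one_mul] at this

theorem gameValue_eq_neg (σ : ∀ i, G.Policy i) (i : Fin 2) :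
    G.gameValue σ i = - G.gameValue σ (1 - i) := by
  have := gameValue_add_gameValue σ
  fin_cases i
  · exact eq_neg_of_add_eq_zero_left this
  · exact eq_neg_of_add_eq_zero_right this

theorem expect_gameValue_deviation_le (hG : G.WellFormed) (S : G.Search) (i : Fin 2) {b : ℝ}
    (h : ∀ π : G.Policy i, deviationValue S i π G.horizon initialPBS [] ≤ b)
    (π : Seed S → G.Policy i) :
    (Finset.expect univ fun ω : Fin 2 → Seed S =>
      G.gameValue (Function.update (fun j => testPolicy S j (ω j)) i (π (ω i))) i) ≤ b := by
  rw [expect_gameValue_deviation hG S i π]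
  exact expect_le univ_nonempty fun ω _ => h _

theorem exists_playsNashInExpectation (hG : G.WellFormed) : ∃ c : ℝ, 0 ≤ c ∧
    ∀ (S : G.Search) (δ : ℝ), 0 ≤ δ → TrainedWithError S δ →
      PlaysNashInExpectation S (c * (δ + 1 / √S.T)) := by
  obtain ⟨e, he, hdev⟩ := exists_deviationValue_initial_le hG
  obtain ⟨c, hc, hsum⟩ := exists_playedValue_add_le hG
  -- One `e` for agent `i`'s deviation, one for the other agent's own play seen as a deviation, and
  -- `c` for the failure of the played values to be exactly zero-sum.
  refine ⟨2 * e + c, by positivity, fun S δ hδ hS i π => ?_⟩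
  have h1 := expect_gameValue_deviation_le hG S i (hdev S δ hδ hS i) fun _ => π
  -- Here the deviation depends on the agent's own seed, which is harmless because that seed is
  -- independent of the opponent's and the bound holds for every fixed policy.
  have h2 := expect_gameValue_deviation_le hG S (1 - i) (hdev S δ hδ hS (1 - i))
    fun ω => testPolicy S (1 - i) ω
  have h3 : (Finset.expect univ fun ω : Fin 2 → Seed S =>
      G.gameValue (fun j => testPolicy S j (ω j)) i) = - Finset.expect univ
      fun ω : Fin 2 → Seed S => G.gameValue (Function.update (fun j => testPolicy S j (ω j))
        (1 - i) (testPolicy S (1 - i) (ω (1 - i)))) (1 - i) := by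
    rw [← expect_neg_distrib]
    refine expect_congr rfl fun ω _ => ?_
    rw [gameValue_eq_neg, Function.update_eq_self (1 - i) fun j => testPolicy S j (ω j)]
  have h4 : playedValue S initialPBS i [] + playedValue S initialPBS (1 - i) [] ≤ c * δ := by
    have := hsum S δ hδ hS
    fin_cases i
    · exact this
    · exact (add_comm _ _).trans_le this
  have h5 : c * δ ≤ c * (δ + 1 / √S.T) :=
    mul_le_mul_of_nonneg_left (le_add_of_nonneg_right (by positivity)) hc
  rw [h3]
  linarith

end Equilibrium

end FOG
end

theorem theorem3 {W : Type*} {A : Fin 2 → Type*} {Opriv : Fin 2 → Type*} {Opub : Type*}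
    [Fintype W] [∀ i, Fintype (A i)] (G : FOG W A Opriv Opub) (hG : G.WellFormed) :
    ∃ C₁ C₂ : ℝ, 0 ≤ C₁ ∧ 0 ≤ C₂ ∧
      ∀ (S : G.Search) (δ : ℝ), 0 ≤ δ → FOG.TrainedWithError S δ →
        FOG.PlaysNashInExpectation S (δ * C₁ + C₂ / Real.sqrt S.T) := by
  obtain ⟨c, hc, h⟩ := FOG.exists_playsNashInExpectation hG
  refine ⟨c, c, hc, hc, fun S δ hδ hS => ?_⟩
  rw [show δ * c + c / √S.T = c * (δ + 1 / √S.T) by ring]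
  exact h S δ hδ hS
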